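/- **Model.** Let $\Pi$ be a finite set of processes. A failure pattern is a non-decreasing map $F:\mathbb N\to 2^\Pi$ ($F(t)$ is the set of processes crashed by time $t$); $\mathrm{correct}(F)=\Pi\setminus\bigcup_t F(t)$. An environment $\mathcal E$ is a set of failure patterns. A failure detector $\mathcal D$ maps each $F$ to a nonempty set of histories $H:\Pi\times\mathbb N\to\mathcal R$. An algorithm is a family of deterministic automata, one per process. In a step a process accepts at most one message or one input, reads its failure-detector value, changes its state, and then does nothing, sends one message to every process (itself included), or returns one output. A run of an algorithm using $\mathcal D$ in $\mathcal E$ consists of $F\in\mathcal E$, $H\in\mathcal D(F)$, an infinite sequence of steps of non-crashed processes taken at strictly increasing times, and the resulting input and output histories; every message received was sent earlier, and no process receives the same copy twice. A run is admissible if every correct process takes infinitely many steps and receives every message sent to it. A problem is a set of acceptable triples (failure pattern, input history, output history). An algorithm solves a problem in $\mathcal E$ using $\mathcal D$ if the triple of each of its admissible runs is acceptable. **ETOB** with message set $M$. Inputs are calls $\mathrm{broadcastETOB}(m)$, $m\in M$; each process $p_i$ maintains an output sequence $d_i$ of messages, initially empty, with value $d_i(t)$ at time $t$. Process $p_i$ stably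 delivers $m$ at time $t$ if $m\notin d_i(t-1)$ and $m\in d_i(t')$ for all $t'\ge t$. Provided that no message is broadcast twice, the following is required. *Validity:* if a correct $p_i$ broadcasts $m$ at time $t$, there is $t'>t$ with $m\in d_i(t'')$ for all $t''\ge t'$. *No-creation:* if $m\in d_i(t)$, then $m$ was broadcast by some process at some time $t'<t$. *No-duplication:* no message appears twice in $d_i(t)$. *Agreement:* if a correct process stably delivers $m$, every correct process eventually stably delivers $m$. Moreover there is $\tau\in\mathbb N$ such that: *Stability:* $d_i(t_1)$ is a prefix of $d_i(t_2)$ for every correct $p_i$ and $\tau\le t_1\le t_2$; *Total order:* for correct $p_i,p_j$ and $t\ge\tau$, if $m_1,m_2$ appear in both $d_i(t)$ and $d_j(t)$ and $m_1$ appears before $m_2$ in $d_i(t)$, then also in $d_j(t)$. **EC** with value set $V$. Inputs are invocations $\mathrm{proposeEC}_j(v)$, outputs are responses $v$ to $\mathrm{proposeEC}_j$ ($j\ge1$, $v\in V$). It is assumed that every process invokes the instances $1,2,\dots$ in order, each at most once and each only after having received a response to the preceding one, and that every correct process does invoke instance $1$ and, after (with a finite delay) each response, the next instance. Under this assumption the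 following is required. A process responds to $\mathrm{proposeEC}_j$ only after invoking it. *Termination:* every correct process responds to $\mathrm{proposeEC}_j$ for all $j\ge1$. *Integrity:* no process responds twice to $\mathrm{proposeEC}_j$. *Validity:* every value returned to $\mathrm{proposeEC}_j$ was previously proposed to $\mathrm{proposeEC}_j$ by some process. *Agreement:* there is $k$ such that no two processes return different values to $\mathrm{proposeEC}_j$ for any $j\ge k$. **Transformations.** The code $W$ of an asynchronous black-box transformation is a family of deterministic automata without access to failure detectors, with messages of their own, that react to application inputs, to their own messages, to local timeouts and to outputs of a black box, and may feed inputs to the black box. For an algorithm $\mathcal A$, $W(\mathcal A)$ is the algorithm in which every process runs $W$ on top of its automaton of $\mathcal A$, queueing what it accepts and scheduling in turn a timeout of $W$, the next waiting stimulus of $W$, and a step of $\mathcal A$ on its next waiting message. $W$ is a transformation from $Q$ to $Q'$ in $\mathcal E$ if, for every failure detector $\mathcal D$ and every algorithm $\mathcal A$ solving $Q$ in $\mathcal E$ using $\mathcal D$, $W(\mathcal A)$ solves $Q'$ in $\mathcal E$ using $\mathcal D$. Two problems are equivalent in $\mathcal E$ if there are transformations both ways. **Theorem.** Let $\mathcal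 E$ be any environment. 1. For all sets $M,V$ and every injective coding of finite sequences over $M$ by elements of $V$, the following $W$ is a transformation from EC (values $V$) to ETOB (messages $M$) in $\mathcal E$. To broadcast $m$, send $\mathrm{push}(m)$ to all; on receiving $\mathrm{push}(m)$, add $m$ to the set $toDeliver$. On the response $d$ to the pending EC instance, set $d_i:=d$. On a local timeout, if no EC instance is pending, propose to the next instance (the first one being $1$) the sequence $d_i$ followed by all messages of $toDeliver$ not in $d_i$. 2. For all sets $M,V$ and every injective coding of triples in $\Pi\times\mathbb N\times V$ by elements of $M$, the following $W$ is a transformation from ETOB (messages $M$) to EC (values $V$) in $\mathcal E$. When $p_i$ invokes $\mathrm{proposeEC}_\ell(v)$, it broadcasts $(p_i,\ell,v)$. On a local timeout, if $p_i$ has not yet responded to its current instance $\ell$ and some message $(\cdot,\ell,\cdot)$ is in $d_i$, it responds with the value in the first such message. 3. In particular, EC and ETOB are equivalent in $\mathcal E$ whenever $V$ is infinite and $M$ has the same cardinality as $V$. -/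

import Mathlib

universe u

namespace EventualConsistency

/-! ### Failures, environments, failure detectors -/

/-- A failure pattern: `crashed t` is the set of processes that have crashed by time `t`;
processes never recover. -/
structure FailurePattern (P : Type) where
  crashed : ℕ → Set P
  mono : ∀ t, crashed t ⊆ crashed (t + 1)

/-- The processes that crash at some time. -/
def FailurePattern.faulty {P : Type} (F : FailurePattern P) : Set P := ⋃ t, F.crashed t

/-- The processes that never crash. -/
def FailurePattern.correct {P : Type} (F : FailurePattern P) : Set P := F.faultyᶜ

/-- An environment is a set of failure patterns. -/
abbrev Environment (P : Type) := Set (FailurePattern P)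

/-- A failure detector with range `R` maps every failure pattern to a nonempty set of histories. -/
structure FailureDetector (P : Type) (R : Type u) where
  histories : FailurePattern P → Set (P → ℕ → R)
  nonempty : ∀ F, (histories F).Nonempty

/-! ### Algorithms and their runs -/

/-- What a process accepts in a step: the empty message, a message, or an input of the
application. -/
inductive Stimulus (Msg I : Type u) : Type u
  | empty : Stimulus Msg I
  | receive (m : Msg) : Stimulus Msg I
  | input (x : I) : Stimulus Msg I

/-- The input accepted, if there is one. -/
def Stimulus.input? {Msg I : Type u} : Stimulus Msg I → Option I
  | .input x => some x
  | _ => none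

/-- What a process does at the end of a step: nothing, send one message to every process
(itself included), or return one output to the application. -/
inductive Action (Msg O : Type u) : Type u
  | idle : Action Msg O
  | send (m : Msg) : Action Msg O
  | output (y : O) : Action Msg O

/-- The output returned, if there is one. -/
def Action.output? {Msg O : Type u} : Action Msg O → Option O
  | .output y => some y
  | _ => none

/-- Renaming of the message sent. -/
def Action.mapMsg {Msg Msg' O : Type u} (f : Msg → Msg') : Action Msg O → Action Msg' O
  | .idle => .idle
  | .send m => .send (f m)
  | .output y => .output y

/-- An algorithm: one deterministic automaton for every process, with failure-detector values in
`R`, inputs in `I` and outputs in `O`. -/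
structure Algorithm (P : Type) (R I O : Type u) where
  State : Type u
  Msg : Type u
  init : P → State
  step : P → State → Stimulus Msg I → R → State × Action Msg O

/-- A step: the process that takes it, what it accepts, the failure-detector value it sees. -/
structure Step (P : Type) (R Msg I : Type u) where
  proc : P
  stimulus : Stimulus Msg I
  fd : R

section Runs

variable {P : Type} {R I O : Type u}

open Classical in
/-- `A.config S n p` is the local state of `p` before the `n`-th step of the schedule `S`. -/
noncomputable def Algorithm.config (A : Algorithm P R I O) (S : ℕ → Step P R A.Msg I) :
    ℕ → P → A.State
  | 0 => A.init
  | n + 1 =>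
      Function.update (A.config S n) (S n).proc
        (A.step (S n).proc (A.config S n (S n).proc) (S n).stimulus (S n).fd).1

/-- The action of the `n`-th step of the schedule `S`. -/
noncomputable def Algorithm.action (A : Algorithm P R I O) (S : ℕ → Step P R A.Msg I) (n : ℕ) :
    Action A.Msg O :=
  (A.step (S n).proc (A.config S n (S n).proc) (S n).stimulus (S n).fd).2

/-- An (infinite) run of the algorithm `A` using the failure detector `D` in the environment `E`.
Messages in transit are accounted for by `origin`: if the `n`-th step receives a message, this
message was sent by the earlier step `origin n`, and no process receives the same message twice. -/
structure Run (A : Algorithm P R I O) (D : FailureDetector P R) (E : Environment P) where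
  /-- failure pattern -/
  F : FailurePattern P
  /-- failure detector history -/
  H : P → ℕ → R
  /-- input history -/
  HI : P → ℕ → Option I
  /-- output history -/
  HO : P → ℕ → Option O
  /-- schedule -/
  S : ℕ → Step P R A.Msg I
  /-- times at which the steps are taken -/
  T : ℕ → ℕ
  origin : ℕ → ℕ
  F_mem : F ∈ E
  H_mem : H ∈ D.histories F
  T_strictMono : StrictMono T
  alive : ∀ n, (S n).proc ∉ F.crashed (T n)
  fd_eq : ∀ n, (S n).fd = H (S n).proc (T n)
  receive_origin : ∀ n m, (S n).stimulus = .receive m →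
    origin n < n ∧ A.action S (origin n) = .send m
  receive_once : ∀ n n' m m', (S n).stimulus = .receive m → (S n').stimulus = .receive m' →
    (S n).proc = (S n').proc → origin n = origin n' → n = n'
  HI_step : ∀ n, HI (S n).proc (T n) = (S n).stimulus.input?
  HI_none : ∀ p t, (∀ n, ¬ (T n = t ∧ (S n).proc = p)) → HI p t = none
  HO_step : ∀ n, HO (S n).proc (T n) = (A.action S n).output?
  HO_none : ∀ p t, (∀ n, ¬ (T n = t ∧ (S n).proc = p)) → HO p t = none

/-- A run is admissible if every correct process takes infinitely many steps and receives every
message that is sent to it. -/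
structure Run.Admissible {A : Algorithm P R I O} {D : FailureDetector P R} {E : Environment P}
    (r : Run A D E) : Prop where
  steps : ∀ p ∈ r.F.correct, ∀ N, ∃ n, N ≤ n ∧ (r.S n).proc = p
  messages : ∀ n m, A.action r.S n = .send m → ∀ p ∈ r.F.correct,
    ∃ n', (r.S n').proc = p ∧ (r.S n').stimulus = .receive m ∧ r.origin n' = n

end Runs

/-- A problem: which input and output histories are acceptable. The failure pattern is an argument
because specifications speak about correct processes. -/
abbrev Problem (P : Type) (I O : Type u) :=
  FailurePattern P → (P → ℕ → Option I) → (P → ℕ → Option O) → Prop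

/-- The algorithm `A` using `D` solves the problem `Q` in the environment `E`. -/
def Solves {P : Type} {R I O : Type u} (A : Algorithm P R I O) (D : FailureDetector P R)
    (E : Environment P) (Q : Problem P I O) : Prop :=
  ∀ r : Run A D E, r.Admissible → Q r.F r.HI r.HO

/-! ### Eventual total order broadcast -/

/-- The value at time `t` of an output variable with initial value `a`, where `h t = some b` means
that the variable is set to `b` at time `t`. -/
def valueAt {α : Type u} (a : α) (h : ℕ → Option α) : ℕ → α
  | 0 => (h 0).getD a
  | t + 1 => (h (t + 1)).getD (valueAt a h t)

/-- With `d t` the delivered sequence at time `t`: the message `m` is stably delivered at time `t`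
(it is not in `d (t - 1)`, which counts as empty for `t = 0`, and it is in `d t'` for all
`t' ≥ t`). -/
def StablyDelivers {M : Type u} (d : ℕ → List M) (m : M) (t : ℕ) : Prop :=
  (∀ s, t = s + 1 → m ∉ d s) ∧ ∀ t', t ≤ t' → m ∈ d t'

/-- `m₁` appears before `m₂` in the sequence `l`. -/
def AppearsBefore {M : Type u} (l : List M) (m₁ m₂ : M) : Prop := List.Sublist [m₁, m₂] l

/-- The guarantees of eventual total order broadcast; an input `m` is the call `broadcastETOB(m)`,
and `d p t` is the value of the output variable of `p` at time `t`. -/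
structure ETOBSpec {P : Type} {M : Type u} (F : FailurePattern P) (HI : P → ℕ → Option M)
    (d : P → ℕ → List M) : Prop where
  validity : ∀ p ∈ F.correct, ∀ m t, HI p t = some m → ∃ t' > t, ∀ t'' ≥ t', m ∈ d p t''
  no_creation : ∀ p t, ∀ m ∈ d p t, ∃ q, ∃ t' < t, HI q t' = some m
  no_duplication : ∀ p t, (d p t).Nodup
  agreement : ∀ p ∈ F.correct, ∀ m t, StablyDelivers (d p) m t →
    ∀ q ∈ F.correct, ∃ t', StablyDelivers (d q) m t'
  eventually : ∃ τ : ℕ,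
    (∀ p ∈ F.correct, ∀ t₁ t₂, τ ≤ t₁ → t₁ ≤ t₂ → d p t₁ <+: d p t₂) ∧
    (∀ p ∈ F.correct, ∀ q ∈ F.correct, ∀ t ≥ τ, ∀ m₁ m₂,
      m₁ ∈ d p t → m₂ ∈ d p t → m₁ ∈ d q t → m₂ ∈ d q t →
      AppearsBefore (d p t) m₁ m₂ → AppearsBefore (d q t) m₁ m₂)

/-- The problem ETOB with messages in `M`: provided that no message is broadcast twice, the
guarantees of eventual total order broadcast hold. An output is a new value of the output variable,
which is initially empty. -/
def ETOB (P : Type) (M : Type u) : Problem P M (List M) := fun F HI HO =>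
  (∀ p q t t' m, HI p t = some m → HI q t' = some m → p = q ∧ t = t') →
    ETOBSpec F HI (fun p => valueAt [] (HO p))

/-! ### Eventual consensus

An input `(j, v)` is the invocation `proposeEC_j(v)`, an output `(j, v)` is the response `v` to
`proposeEC_j`; the instances are `j = 1, 2, …`. -/

/-- The assumption on the application: every process invokes the instances one after the other,
each at most once and each only after the response to the preceding one; and a correct process does
invoke the first instance, and the next one after every response. -/
structure ECInputs {P : Type} {V : Type u} (F : FailurePattern P)
    (HI HO : P → ℕ → Option (ℕ × V)) : Prop where
  pos : ∀ p t j v, HI p t = some (j, v) → 1 ≤ j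
  once : ∀ p j t t' v v', HI p t = some (j, v) → HI p t' = some (j, v') → t = t'
  order : ∀ p j t v, 1 ≤ j → HI p t = some (j + 1, v) →
    ∃ t₁ t₂, t₁ ≤ t₂ ∧ t₂ < t ∧ (∃ x, HI p t₁ = some (j, x)) ∧ ∃ y, HO p t₂ = some (j, y)
  first : ∀ p ∈ F.correct, ∃ t v, HI p t = some (1, v)
  next : ∀ p ∈ F.correct, ∀ j t₁ t₂ x y, t₁ ≤ t₂ → HI p t₁ = some (j, x) →
    HO p t₂ = some (j, y) → ∃ t v, HI p t = some (j + 1, v)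

/-- The guarantees of eventual consensus. -/
structure ECSpec {P : Type} {V : Type u} (F : FailurePattern P)
    (HI HO : P → ℕ → Option (ℕ × V)) : Prop where
  /-- Responses are responses: they come (possibly within the same step) after the invocation. -/
  response : ∀ p t j v, HO p t = some (j, v) → ∃ t' ≤ t, ∃ x, HI p t' = some (j, x)
  termination : ∀ p ∈ F.correct, ∀ j ≥ 1, ∃ t v, HO p t = some (j, v)
  integrity : ∀ p j t t' v v', HO p t = some (j, v) → HO p t' = some (j, v') → t = t'
  validity : ∀ p t j v, HO p t = some (j, v) → ∃ q, ∃ t' ≤ t, HI q t' = some (j, v)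
  agreement : ∃ k : ℕ, ∀ j ≥ k, ∀ p q t t' v v', HO p t = some (j, v) → HO q t' = some (j, v') →
    v = v'

/-- The problem EC (multivalued, with values in `V`). -/
def EC (P : Type) (V : Type u) : Problem P (ℕ × V) (ℕ × V) := fun F HI HO =>
  ECInputs F HI HO → ECSpec F HI HO

/-! ### Asynchronous black-box transformations -/

/-- What the code of a transformation does at the end of a local step: an action of its own, or
feeding one input to the black box. -/
inductive Command (Msg I O' : Type u) : Type u
  | act (a : Action Msg O') : Command Msg I O'
  | call (x : I) : Command Msg I O'

/-- The code of a transformation that uses a black box with inputs `I` and outputs `O` and offers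
inputs `I'` and outputs `O'` to the application. It has states and messages of its own and no access
to failure detectors. `step` is its reaction to an input of the application, to one of its own
messages, and (`Stimulus.empty`) to a local timeout; `respond` is its reaction to an output of the
black box. -/
structure Transformer (P : Type) (I O I' O' : Type u) where
  State : Type u
  Msg : Type u
  init : P → State
  step : P → State → Stimulus Msg I' → State × Command Msg I O'
  respond : P → State → O → State × Action Msg O'

section Composition

variable {P : Type} {R I O I' O' : Type u}

/-- Local state of a process that runs the transformation `W` on top of its copy of the black box
`A`: the two states, the stimuli not yet handled by `W`, the messages not yet handed to `A`, and the
turn of the local round-robin scheduler. -/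
structure CompState (W : Transformer P I O I' O') (A : Algorithm P R I O) : Type u where
  user : W.State
  box : A.State
  userQueue : List (Stimulus W.Msg I')
  boxQueue : List A.Msg
  turn : Fin 3

variable (W : Transformer P I O I' O') (A : Algorithm P R I O)

/-- The black box takes one step; its output, if any, is handed to the transformation. -/
def boxStep (p : P) (s : CompState W A) (e : Stimulus A.Msg I) (d : R) :
    CompState W A × Action (W.Msg ⊕ A.Msg) O' :=
  let b := A.step p s.box e d
  match b.2 with
  | .idle => ({ s with box := b.1 }, .idle)
  | .send m => ({ s with box := b.1 }, .send (.inr m))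
  | .output y =>
      let w := W.respond p s.user y
      ({ s with box := b.1, user := w.1 }, w.2.mapMsg .inl)

/-- The transformation takes one step; an input it feeds to the black box is accepted at once. -/
def userStep (p : P) (s : CompState W A) (e : Stimulus W.Msg I') (d : R) :
    CompState W A × Action (W.Msg ⊕ A.Msg) O' :=
  let w := W.step p s.user e
  match w.2 with
  | .act a => ({ s with user := w.1 }, a.mapMsg .inl)
  | .call x => boxStep W A p { s with user := w.1 } (.input x) d

/-- Whatever a process accepts is first put into a queue. -/
def enqueue (s : CompState W A) (e : Stimulus (W.Msg ⊕ A.Msg) I') : CompState W A :=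
  match e with
  | .empty => s
  | .receive (.inl m) => { s with userQueue := s.userQueue ++ [.receive m] }
  | .receive (.inr m) => { s with boxQueue := s.boxQueue ++ [m] }
  | .input x => { s with userQueue := s.userQueue ++ [.input x] }

/-- One local job, in turn: a local timeout of the transformation; the first waiting stimulus of the
transformation; a step of the black box with its first waiting message (or the empty message). -/
def localStep (p : P) (s : CompState W A) (d : R) :
    CompState W A × Action (W.Msg ⊕ A.Msg) O' :=
  match s.turn with
  | 0 => userStep W A p s .empty d
  | 1 =>
      match s.userQueue with
      | [] => (s, .idle)
      | e :: q => userStep W A p { s with userQueue := q } e d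
  | 2 =>
      match s.boxQueue with
      | [] => boxStep W A p s .empty d
      | m :: q => boxStep W A p { s with boxQueue := q } (.receive m) d

/-- The algorithm obtained by running the transformation `W` on top of the black box `A`. -/
def Transformer.apply : Algorithm P R I' O' where
  State := CompState W A
  Msg := W.Msg ⊕ A.Msg
  init p := ⟨W.init p, A.init p, [], [], 0⟩
  step p s e d :=
    let r := localStep W A p (enqueue W A s e) d
    ({ r.1 with turn := r.1.turn + 1 }, r.2)

end Composition

/-- `W` is an asynchronous transformation from `Q` to `Q'` in the environment `E`: applied to any
algorithm that solves `Q` in `E`, using any failure detector, it yields an algorithm that solves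
`Q'` in `E` using the same failure detector. -/
def IsTransformation {P : Type} {I O I' O' : Type u} (E : Environment P)
    (Q : Problem P I O) (Q' : Problem P I' O') (W : Transformer P I O I' O') : Prop :=
  ∀ (R : Type u) (D : FailureDetector P R) (A : Algorithm P R I O),
    Solves A D E Q → Solves (W.apply A) D E Q'

/-- The two problems are equivalent in `E`: there are transformations both ways. -/
def EquivalentIn {P : Type} {I O I' O' : Type u} (E : Environment P)
    (Q : Problem P I O) (Q' : Problem P I' O') : Prop :=
  (∃ W : Transformer P I O I' O', IsTransformation E Q Q' W) ∧
    ∃ W' : Transformer P I' O' I O, IsTransformation E Q' Q W'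

/-! ### The transformation from EC to ETOB -/

/-- `d`: the delivered sequence; `toDeliver`: the messages received; `count`: the last instance of
EC invoked; `pending`: whether its response is still awaited. -/
structure ECToETOBState (M : Type u) : Type u where
  d : List M
  toDeliver : Finset M
  count : ℕ
  pending : Bool

open Classical in
/-- A sequence of all messages that are in `toDeliver` and not in `d`. -/
noncomputable def newBatch {M : Type u} (d : List M) (toDeliver : Finset M) : List M :=
  (toDeliver \ d.toFinset).toList

open Classical in
/-- Sequences of messages are proposed to EC through the coding `enc`.
`broadcastETOB(m)`: send `push(m)` to all. `push(m)`: add `m` to `toDeliver`. Response to the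
pending instance: deliver the sequence returned. Local timeout: if no instance is pending, propose
`d` followed by the new batch to the next instance. -/
noncomputable def ecToETOB (P : Type) {M V : Type u} (enc : List M ↪ V) :
    Transformer P (ℕ × V) (ℕ × V) M (List M) where
  State := ECToETOBState M
  Msg := M
  init _ := ⟨[], ∅, 0, false⟩
  step _ s e :=
    match e with
    | .input m => (s, .act (.send m))
    | .receive m => ({ s with toDeliver := insert m s.toDeliver }, .act .idle)
    | .empty =>
        if s.pending then (s, .act .idle)
        else ({ s with count := s.count + 1, pending := true },
          .call (s.count + 1, enc (s.d ++ newBatch s.d s.toDeliver)))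
  respond _ s y :=
    if s.pending = true ∧ y.1 = s.count then
      let l := (Function.partialInv enc y.2).getD []
      ({ s with d := l, pending := false }, .output l)
    else (s, .idle)

/-! ### The transformation from ETOB to EC -/

/-- `d`: the sequence output by ETOB; `count`: the last instance invoked by the application;
`pending`: whether this process still owes the response to it. -/
structure ETOBToECState (M : Type u) : Type u where
  d : List M
  count : ℕ
  pending : Bool

/-- The value `v` of the first message `(q, ℓ, v)` of instance `ℓ` in the sequence `d`, if any. -/
noncomputable def firstValue {P : Type} {M V : Type u} (enc : P × ℕ × V ↪ M) (ℓ : ℕ)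
    (d : List M) : Option V :=
  d.findSome? fun m =>
    (Function.partialInv enc m).bind fun x => if x.2.1 = ℓ then some x.2.2 else none

/-- Triples (proposing process, instance, value) are broadcast through the coding `enc`.
`proposeEC_ℓ(v)` at `p`: set `count` to `ℓ` and broadcast `(p, ℓ, v)`. Local timeout: if the current
instance awaits its response and some message of this instance is in `d`, respond with the value in
the first such message. -/
noncomputable def etobToEC {P : Type} {M V : Type u} (enc : P × ℕ × V ↪ M) :
    Transformer P M (List M) (ℕ × V) (ℕ × V) where
  State := ETOBToECState M
  Msg := PEmpty
  init _ := ⟨[], 0, false⟩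
  step p s e :=
    match e with
    | .input x => ({ s with count := x.1, pending := true }, .call (enc (p, x.1, x.2)))
    | .receive m => m.elim
    | .empty =>
        if s.pending then
          match firstValue enc s.count s.d with
          | some v => ({ s with pending := false }, .act (.output (s.count, v)))
          | none => (s, .act .idle)
        else (s, .act .idle)
  respond _ s l := ({ s with d := l }, .idle)

end EventualConsistency

open EventualConsistency

/-! Reduction to the black box. A run of `W.apply A` contains a run of `A`: keep the steps in which
the black box moves, renumber them, and keep the failure pattern, the detector history and the
times. A message of the black box may wait in a local queue, and equal messages may wait together,
so queue entries are tagged with their arrival (`exists_queue_source`); this shows that no copy is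
received twice and that none is lost at a correct process. Round-robin scheduling supplies fairness.
`exists_boxRun` and `box_acceptable` record the result: the black box inside an admissible run
satisfies its specification.

From EC to ETOB. The application assumption of EC has to be checked first, without help from EC,
whose guarantees depend on it (`ecInputs`). Then every response to instance `j + 1` was proposed by
a process that had adopted a response to `j`, and it extends that response
(`exists_isResponse_prefix`). Once the responses to each instance are unique, they form a single
chain under the prefix order (`isResponse_prefix`), which gives stability and total order. For
validity, a message broadcast by a correct process reaches `toDeliver` at all correct processes;
later proposals all contain it, and only finitely many instances were proposed to earlier
(`ec_validity`). For agreement, a message that stays in the sequence of one correct process lies in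
the unique response to every late instance (`ec_agreement`).

From ETOB to EC. A triple names its sender and its instance, so no message is broadcast twice. A
pending invocation stays pending until it is answered, and the process's own triple eventually
arrives, so it is answered (`exists_responds`). After stabilisation the first message of instance
`j` at a responding process remains first there, and it reaches every correct process. Two different
first messages would appear in opposite orders in two sequences that contain both, against total
order. Late instances are answered only by correct processes, because finitely many processes take
steps and each faulty one stops.

Equivalence is then a matter of codings: an infinite set has as many finite sequences as elements.
-/

namespace EventualConsistency

open Filter

/-! ### One local step of a composed process -/

/-- The black-box input contained in a command, if there is one. -/
def Command.call? {Msg I O' : Type u} : Command Msg I O' → Option I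
  | .call x => some x
  | .act _ => none

section LocalStep

variable {P : Type} {R I O I' O' : Type u} {W : Transformer P I O I' O'} {A : Algorithm P R I O}

/-- The stimulus that the transformation handles in the next local step, if any. -/
def userEvent (s : CompState W A) : Option (Stimulus W.Msg I') :=
  if s.turn = 0 then some .empty else if s.turn = 1 then s.userQueue.head? else none

/-- The command issued by the transformation in the next local step, if any. -/
def userCommand (p : P) (s : CompState W A) : Option (Command W.Msg I O') :=
  (userEvent s).map fun e => (W.step p s.user e).2

/-- The state of the transformation after it has handled its stimulus and before it handles an
output of the black box. -/
def userMid (p : P) (s : CompState W A) : W.State :=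
  (userEvent s).elim s.user fun e => (W.step p s.user e).1

/-- The stimulus that the black box accepts in the next local step, if it takes one. -/
def boxEvent (p : P) (s : CompState W A) : Option (Stimulus A.Msg I) :=
  if s.turn = 2 then some (s.boxQueue.head?.elim .empty .receive)
  else ((userCommand p s).bind Command.call?).map .input

/-- The action of the black box in the next local step, if it takes one. -/
def boxAction (p : P) (s : CompState W A) (d : R) : Option (Action A.Msg O) :=
  (boxEvent p s).map fun e => (A.step p s.box e d).2

/-- The output of the black box in the next local step, if any. -/
def boxOutput (p : P) (s : CompState W A) (d : R) : Option O :=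
  (boxAction p s d).bind Action.output?

theorem boxStep_fst (p : P) (s : CompState W A) (e : Stimulus A.Msg I) (d : R) :
    (boxStep W A p s e d).1 =
      { s with
        box := (A.step p s.box e d).1
        user := (A.step p s.box e d).2.output?.elim s.user fun y => (W.respond p s.user y).1 } := by
  unfold boxStep
  cases h : (A.step p s.box e d).2 <;> simp [Action.output?, h]

/-- The action of a composed process in which the black box acts by `a`. -/
def liftAction (p : P) (u : W.State) : Action A.Msg O → Action (W.Msg ⊕ A.Msg) O'
  | .idle => .idle
  | .send m => .send (.inr m)
  | .output y => (W.respond p u y).2.mapMsg .inl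

theorem boxStep_snd (p : P) (s : CompState W A) (e : Stimulus A.Msg I) (d : R) :
    (boxStep W A p s e d).2 = liftAction p s.user (A.step p s.box e d).2 := by
  unfold boxStep liftAction
  cases h : (A.step p s.box e d).2 <;> simp [h]

theorem fin3_cases (t : Fin 3) : t = 0 ∨ t = 1 ∨ t = 2 := by
  fin_cases t <;> simp

/-- The three jobs of the scheduler are brought to one formula, so that later arguments need `turn`
only for fairness and for the queues. -/
theorem localStep_fst (p : P) (s : CompState W A) (d : R) :
    (localStep W A p s d).1 =
      { user := (boxOutput p s d).elim (userMid p s) fun y => (W.respond p (userMid p s) y).1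
        box := (boxEvent p s).elim s.box fun e => (A.step p s.box e d).1
        userQueue := if s.turn = 1 then s.userQueue.tail else s.userQueue
        boxQueue := if s.turn = 2 then s.boxQueue.tail else s.boxQueue
        turn := s.turn } := by
  obtain ⟨user, box, uq, bq, turn⟩ := s
  rcases fin3_cases turn with rfl | rfl | rfl
  · cases h : (W.step p user .empty).2 <;>
      simp [localStep, userStep, boxOutput, boxAction, boxEvent, userCommand, userEvent, userMid,
        Command.call?, h, boxStep_fst]
  · cases uq with
    | nil =>
      simp [localStep, boxOutput, boxAction, boxEvent, userCommand, userEvent, userMid]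
    | cons e q =>
      cases h : (W.step p user e).2 <;>
        simp [localStep, userStep, boxOutput, boxAction, boxEvent, userCommand, userEvent, userMid,
          Command.call?, h, boxStep_fst]
  · cases bq <;>
      simp [localStep, boxOutput, boxAction, boxEvent, userEvent, userMid, boxStep_fst]

theorem localStep_snd (p : P) (s : CompState W A) (d : R) :
    (localStep W A p s d).2 =
      (boxAction p s d).elim
        ((userCommand p s).elim .idle fun c => match c with
          | .act a => a.mapMsg .inl
          | .call _ => .idle)
        (liftAction p (userMid p s)) := by
  obtain ⟨user, box, uq, bq, turn⟩ := s
  rcases fin3_cases turn with rfl | rfl | rfl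
  · cases h : (W.step p user .empty).2 <;>
      simp [localStep, userStep, boxAction, boxEvent, userCommand, userEvent, userMid,
        Command.call?, h, boxStep_snd]
  · cases uq with
    | nil =>
      simp [localStep, boxAction, boxEvent, userCommand, userEvent]
    | cons e q =>
      cases h : (W.step p user e).2 <;>
        simp [localStep, userStep, boxAction, boxEvent, userCommand, userEvent, userMid,
          Command.call?, h, boxStep_snd]
  · cases bq <;>
      simp [localStep, boxAction, boxEvent, userEvent, userMid, boxStep_snd]

/-- At turn 2 the black box accepts a message or nothing, so an input can only come from a `call`.
-/
theorem boxEvent_eq_input_iff {p : P} {s : CompState W A} {x : I} :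
    boxEvent p s = some (.input x) ↔
      ∃ e, userEvent s = some e ∧ (W.step p s.user e).2 = .call x := by
  obtain ⟨user, box, uq, bq, turn⟩ := s
  rcases fin3_cases turn with rfl | rfl | rfl
  · cases h : (W.step p user .empty).2 <;>
      simp [boxEvent, userCommand, userEvent, Command.call?, h]
  · cases uq with
    | nil => simp [boxEvent, userCommand, userEvent]
    | cons e q =>
      cases h : (W.step p user e).2 <;>
        simp [boxEvent, userCommand, userEvent, Command.call?, h]
  · cases bq <;> simp [boxEvent, userEvent]

theorem boxEvent_eq_receive_iff {p : P} {s : CompState W A} {m : A.Msg} :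
    boxEvent p s = some (.receive m) ↔ s.turn = 2 ∧ s.boxQueue.head? = some m := by
  by_cases h : s.turn = 2
  · cases h' : s.boxQueue <;> simp [boxEvent, h, h']
  · rw [boxEvent, if_neg h]
    cases (userCommand p s).bind Command.call? <;> simp [h]

theorem mapMsg_inl_ne_send_inr {α β γ : Type u} (a : Action α γ) (m : β) :
    a.mapMsg (Sum.inl : α → α ⊕ β) ≠ .send (.inr m) := by
  cases a <;> simp [Action.mapMsg]

theorem mapMsg_inl_eq_send_inl {α β γ : Type u} {a : Action α γ} {m : α} :
    a.mapMsg (Sum.inl : α → α ⊕ β) = .send (.inl m) ↔ a = .send m := by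
  cases a <;> simp [Action.mapMsg]

theorem mapMsg_eq_output {α β γ : Type u} {f : α → β} {a : Action α γ} {y : γ} :
    a.mapMsg f = .output y ↔ a = .output y := by
  cases a <;> simp [Action.mapMsg]

/-- Whatever the transformation sends carries the tag `inl`. Hence a message tagged `inr` identifies
the step that sent it as a step of the black box, which is what allows origins to be traced. -/
theorem localStep_snd_eq_send_inr_iff {p : P} {s : CompState W A} {d : R} {m : A.Msg} :
    (localStep W A p s d).2 = .send (.inr m) ↔ boxAction p s d = some (.send m) := by
  rw [localStep_snd]
  rcases h : boxAction p s d with _ | _ | _ | _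
  · rcases h' : userCommand p s with _ | _ | _ <;> simp [mapMsg_inl_ne_send_inr]
  all_goals simp [liftAction, mapMsg_inl_ne_send_inr]

theorem boxAction_of_act {p : P} {s : CompState W A} {d : R} {e : Stimulus W.Msg I'}
    {a : Action W.Msg O'} (he : userEvent s = some e) (ha : (W.step p s.user e).2 = .act a) :
    boxAction p s d = none := by
  have h2 : s.turn ≠ 2 := by
    intro h
    simp [userEvent, h] at he
  simp [boxAction, boxEvent, h2, userCommand, he, ha, Command.call?]

theorem boxOutput_eq_some {p : P} {s : CompState W A} {d : R} {y : O} :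
    boxOutput p s d = some y ↔ boxAction p s d = some (.output y) := by
  unfold boxOutput
  rcases boxAction p s d with _ | _ | _ | _ <;> simp [Action.output?]

theorem localStep_snd_eq_send_inl_iff {p : P} {s : CompState W A} {d : R} {m : W.Msg} :
    (localStep W A p s d).2 = .send (.inl m) ↔
      (∃ y, boxOutput p s d = some y ∧ (W.respond p (userMid p s) y).2 = .send m) ∨
        ∃ e, userEvent s = some e ∧ (W.step p s.user e).2 = .act (.send m) := by
  constructor
  · intro h
    rw [localStep_snd] at h
    rcases h1 : boxAction p s d with _ | _ | _ | y <;> rw [h1] at h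
    · rcases he : userEvent s with _ | e
      · simp [userCommand, he] at h
      · rcases hc : (W.step p s.user e).2 with a | _
        · exact .inr ⟨e, rfl, by simpa [userCommand, he, hc, mapMsg_inl_eq_send_inl] using h⟩
        · simp [userCommand, he, hc] at h
    · simp [liftAction] at h
    · simp [liftAction] at h
    · exact .inl ⟨y, boxOutput_eq_some.2 h1, by
        simpa [liftAction, mapMsg_inl_eq_send_inl] using h⟩
  · rintro (⟨y, h1, h2⟩ | ⟨e, h1, h2⟩) <;> rw [localStep_snd]
    · simp [boxOutput_eq_some.1 h1, liftAction, h2, Action.mapMsg]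
    · simp [boxAction_of_act h1 h2, userCommand, h1, h2, Action.mapMsg]

theorem localStep_snd_eq_output_iff {p : P} {s : CompState W A} {d : R} {z : O'} :
    (localStep W A p s d).2 = .output z ↔
      (∃ y, boxOutput p s d = some y ∧ (W.respond p (userMid p s) y).2 = .output z) ∨
        ∃ e, userEvent s = some e ∧ (W.step p s.user e).2 = .act (.output z) := by
  constructor
  · intro h
    rw [localStep_snd] at h
    rcases h1 : boxAction p s d with _ | _ | _ | y <;> rw [h1] at h
    · rcases he : userEvent s with _ | e
      · simp [userCommand, he] at h
      · rcases hc : (W.step p s.user e).2 with a | _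
        · exact .inr ⟨e, rfl, by simpa [userCommand, he, hc, mapMsg_eq_output] using h⟩
        · simp [userCommand, he, hc] at h
    · simp [liftAction] at h
    · simp [liftAction] at h
    · exact .inl ⟨y, boxOutput_eq_some.2 h1, by
        simpa [liftAction, mapMsg_eq_output] using h⟩
  · rintro (⟨y, h1, h2⟩ | ⟨e, h1, h2⟩) <;> rw [localStep_snd]
    · simp [boxOutput_eq_some.1 h1, liftAction, h2, Action.mapMsg]
    · simp [boxAction_of_act h1 h2, userCommand, h1, h2, Action.mapMsg]

end LocalStep

/-! ### First-in-first-out queues -/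

section Fifo

variable {α : Type u} (arr : ℕ → Option α) (pop : ℕ → Prop)

open Classical in
/-- Contents before the `n`-th step of a queue, initially empty, where every step `n` first appends
`arr n` and then, if `pop n`, removes the first entry. Entries are tagged by the step in which
they arrived. -/
noncomputable def taggedQueue : ℕ → List (ℕ × α)
  | 0 => []
  | n + 1 =>
      if pop n then (taggedQueue n ++ ((arr n).map (Prod.mk n)).toList).tail
      else taggedQueue n ++ ((arr n).map (Prod.mk n)).toList

/-- The tagged queue in the `n`-th step, after the arrival and before the removal. -/
noncomputable def taggedFull (n : ℕ) : List (ℕ × α) :=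
  taggedQueue arr pop n ++ ((arr n).map (Prod.mk n)).toList

variable {arr pop}

theorem taggedQueue_succ_of_pop {n : ℕ} (h : pop n) :
    taggedQueue arr pop (n + 1) = (taggedFull arr pop n).tail := by
  simp [taggedQueue, taggedFull, h]

theorem taggedQueue_succ_of_not_pop {n : ℕ} (h : ¬ pop n) :
    taggedQueue arr pop (n + 1) = taggedFull arr pop n := by
  simp [taggedQueue, taggedFull, h]

theorem taggedQueue_succ_sublist (n : ℕ) :
    List.Sublist (taggedQueue arr pop (n + 1)) (taggedFull arr pop n) := by
  by_cases h : pop n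
  · rw [taggedQueue_succ_of_pop h]; exact List.tail_sublist _
  · rw [taggedQueue_succ_of_not_pop h]

theorem mem_taggedFull {n : ℕ} {x : ℕ × α} :
    x ∈ taggedFull arr pop n ↔
      x ∈ taggedQueue arr pop n ∨ x.1 = n ∧ arr n = some x.2 := by
  obtain ⟨i, a⟩ := x
  simp [taggedFull, Option.map_eq_some_iff]
  grind

theorem taggedFull_spec_of_taggedQueue {n : ℕ}
    (h : (∀ x ∈ taggedQueue arr pop n, x.1 < n ∧ arr x.1 = some x.2) ∧
      (taggedQueue arr pop n).Pairwise (fun x y => x.1 < y.1)) :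
    (∀ x ∈ taggedFull arr pop n, x.1 ≤ n ∧ arr x.1 = some x.2) ∧
      (taggedFull arr pop n).Pairwise (fun x y => x.1 < y.1) := by
  refine ⟨fun x hx => ?_, ?_⟩
  · rcases mem_taggedFull.1 hx with h' | ⟨h', h''⟩
    · exact ⟨(h.1 x h').1.le, (h.1 x h').2⟩
    · exact ⟨h'.le, by rw [h', h'']⟩
  · unfold taggedFull
    rw [List.pairwise_append]
    refine ⟨h.2, by cases arr n <;> simp, fun x hx y hy => ?_⟩
    simp only [Option.mem_toList, Option.map_eq_some_iff] at hy
    obtain ⟨b, -, rfl⟩ := hy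
    exact (h.1 x hx).1

theorem taggedQueue_spec (n : ℕ) :
    (∀ x ∈ taggedQueue arr pop n, x.1 < n ∧ arr x.1 = some x.2) ∧
      (taggedQueue arr pop n).Pairwise (fun x y => x.1 < y.1) := by
  induction n with
  | zero => simp [taggedQueue]
  | succ n ih =>
    have h := taggedFull_spec_of_taggedQueue ih
    refine ⟨fun x hx => ?_, List.Pairwise.sublist (taggedQueue_succ_sublist n) h.2⟩
    have := h.1 x ((taggedQueue_succ_sublist n).subset hx)
    exact ⟨Nat.lt_succ_of_le this.1, this.2⟩

theorem taggedFull_spec (n : ℕ) :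
    (∀ x ∈ taggedFull arr pop n, x.1 ≤ n ∧ arr x.1 = some x.2) ∧
      (taggedFull arr pop n).Pairwise (fun x y => x.1 < y.1) :=
  taggedFull_spec_of_taggedQueue (taggedQueue_spec n)

/-- Tags increase along the queue, so all that stays behind a removed head has a larger tag, and
later arrivals are tagged by later steps. -/
theorem taggedQueue_fst_gt {n : ℕ} (hn : pop n) {x : ℕ × α}
    (hx : (taggedFull arr pop n).head? = some x) {m : ℕ} (hm : n < m) :
    ∀ y ∈ taggedQueue arr pop m, x.1 < y.1 := by
  have hxn : x.1 ≤ n := ((taggedFull_spec n).1 x (List.mem_of_mem_head? hx)).1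
  induction m, hm using Nat.le_induction with
  | base =>
    intro y hy
    rw [taggedQueue_succ_of_pop hn] at hy
    have hp := (taggedFull_spec (arr := arr) (pop := pop) n).2
    rcases h : taggedFull arr pop n with _ | ⟨a, l⟩
    · simp [h] at hx
    · simp only [h, List.head?_cons, Option.some.injEq] at hx
      simp only [h, List.tail_cons] at hy
      rw [h, List.pairwise_cons] at hp
      exact hx ▸ hp.1 y hy
  | succ m hm ih =>
    intro y hy
    rcases mem_taggedFull.1 ((taggedQueue_succ_sublist m).subset hy) with h | ⟨h, -⟩
    · exact ih y h
    · omega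

/-- No arrival is removed twice. -/
theorem taggedFull_head_injective {n n' : ℕ} (hn : pop n) (hn' : pop n') {x x' : ℕ × α}
    (hx : (taggedFull arr pop n).head? = some x) (hx' : (taggedFull arr pop n').head? = some x')
    (h : x.1 = x'.1) : n = n' := by
  have aux : ∀ {n n' : ℕ} {x x' : ℕ × α}, pop n → (taggedFull arr pop n).head? = some x →
      (taggedFull arr pop n').head? = some x' → n < n' → x.1 < x'.1 := by
    intro n n' x x' hn hx hx' hlt
    rcases mem_taggedFull.1 (List.mem_of_mem_head? hx') with h' | ⟨h', -⟩
    · exact taggedQueue_fst_gt hn hx hlt _ h'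
    · have := ((taggedFull_spec n).1 x (List.mem_of_mem_head? hx)).1
      omega
  rcases lt_trichotomy n n' with h1 | h1 | h1
  · exact absurd h (aux hn hx hx' h1).ne
  · exact h1
  · exact absurd h.symm (aux hn' hx' hx h1).ne

/-- If entries are removed again and again, every arrival is removed. -/
theorem exists_taggedFull_head (hpop : ∀ N, ∃ n, N ≤ n ∧ pop n) {i : ℕ} {a : α}
    (ha : arr i = some a) :
    ∃ n, i ≤ n ∧ pop n ∧ (taggedFull arr pop n).head? = some (i, a) := by
  -- Double induction: `k` is the position of the entry in the queue and `d` the distance to some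
  -- later removal. A removal lowers `k`; a step without removal lowers `d`.
  have key : ∀ k d n : ℕ, pop (n + d) → (taggedFull arr pop n)[k]? = some (i, a) →
      ∃ n', n ≤ n' ∧ pop n' ∧ (taggedFull arr pop n').head? = some (i, a) := by
    have hmono : ∀ {k n : ℕ} {x : ℕ × α}, (taggedQueue arr pop n)[k]? = some x →
        (taggedFull arr pop n)[k]? = some x := by
      intro k n x h
      unfold taggedFull
      rw [List.getElem?_append_left, h]
      exact (List.getElem?_eq_some_iff.1 h).1
    intro k
    induction k with
    | zero =>
      intro d
      induction d with
      | zero => exact fun n hp h => ⟨n, le_rfl, hp, by rw [List.head?_eq_getElem?, h]⟩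
      | succ d ih =>
        intro n hp h
        by_cases hn : pop n
        · exact ⟨n, le_rfl, hn, by rw [List.head?_eq_getElem?, h]⟩
        · obtain ⟨n', h1, h2⟩ := ih (n + 1) (by convert hp using 1; omega)
            (hmono (by rw [taggedQueue_succ_of_not_pop hn, h]))
          exact ⟨n', by omega, h2⟩
    | succ k ihk =>
      have hstep : ∀ n, pop n → (taggedFull arr pop n)[k + 1]? = some (i, a) →
          ∃ n', n ≤ n' ∧ pop n' ∧ (taggedFull arr pop n').head? = some (i, a) := by
        intro n hn h
        obtain ⟨N, hN, hp⟩ := hpop (n + 1)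
        obtain ⟨e, rfl⟩ := Nat.exists_eq_add_of_le hN
        obtain ⟨n', h1, h2⟩ := ihk e (n + 1) hp
          (hmono (by rw [taggedQueue_succ_of_pop hn, List.getElem?_tail, h]))
        exact ⟨n', by omega, h2⟩
      intro d
      induction d with
      | zero => exact hstep
      | succ d ih =>
        intro n hp h
        by_cases hn : pop n
        · exact hstep n hn h
        · obtain ⟨n', h1, h2⟩ := ih (n + 1) (by convert hp using 1; omega)
            (hmono (by rw [taggedQueue_succ_of_not_pop hn, h]))
          exact ⟨n', by omega, h2⟩
  obtain ⟨N, hN, hp⟩ := hpop i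
  obtain ⟨e, rfl⟩ := Nat.exists_eq_add_of_le hN
  -- The arrival of step `i` is appended at the end, so its position is the length of the queue
  -- before it.
  exact key (taggedQueue arr pop i).length e i hp (by simp [taggedFull, ha])

/-- A queue with these arrivals and removals consists of the tagged entries. -/
theorem map_snd_taggedFull {q : ℕ → List α} (h0 : q 0 = [])
    (hp : ∀ n, pop n → q (n + 1) = (q n ++ (arr n).toList).tail)
    (hn : ∀ n, ¬ pop n → q (n + 1) = q n ++ (arr n).toList) (n : ℕ) :
    (taggedFull arr pop n).map Prod.snd = q n ++ (arr n).toList := by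
  have hq : ∀ n, (taggedQueue arr pop n).map Prod.snd = q n →
      (taggedFull arr pop n).map Prod.snd = q n ++ (arr n).toList := by
    intro n h
    unfold taggedFull
    rw [List.map_append, h]
    cases arr n <;> simp
  refine hq n ?_
  induction n with
  | zero => simp [taggedQueue, h0]
  | succ n ih =>
    by_cases h : pop n
    · rw [taggedQueue_succ_of_pop h, hp n h, List.map_tail, hq n ih]
    · rw [taggedQueue_succ_of_not_pop h, hn n h, hq n ih]

/-- The entries removed from a queue can be traced back to their arrivals: different removals to
different arrivals, and if entries are removed again and again, every arrival is removed. -/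
theorem exists_queue_source {q : ℕ → List α} (h0 : q 0 = [])
    (hp : ∀ n, pop n → q (n + 1) = (q n ++ (arr n).toList).tail)
    (hn : ∀ n, ¬ pop n → q (n + 1) = q n ++ (arr n).toList) :
    ∃ src : ℕ → ℕ,
      (∀ n a, pop n → (q n ++ (arr n).toList).head? = some a → src n ≤ n ∧ arr (src n) = some a) ∧
      (∀ n n' a a', pop n → pop n' → (q n ++ (arr n).toList).head? = some a →
        (q n' ++ (arr n').toList).head? = some a' → src n = src n' → n = n') ∧
      ((∀ N, ∃ n, N ≤ n ∧ pop n) → ∀ i a, arr i = some a →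
        ∃ n, i ≤ n ∧ pop n ∧ (q n ++ (arr n).toList).head? = some a ∧ src n = i) := by
  have hq := map_snd_taggedFull (arr := arr) (pop := pop) h0 hp hn
  have hhead : ∀ n a, (q n ++ (arr n).toList).head? = some a →
      ∃ i, (taggedFull arr pop n).head? = some (i, a) := by
    intro n a h
    rw [← hq, List.head?_map, Option.map_eq_some_iff] at h
    obtain ⟨⟨i, _⟩, h, rfl⟩ := h
    exact ⟨i, h⟩
  refine ⟨fun n => ((taggedFull arr pop n).head?.map Prod.fst).getD 0, ?_, ?_, ?_⟩
  · intro n a _ h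
    obtain ⟨i, hi⟩ := hhead n a h
    simpa [hi] using (taggedFull_spec n).1 _ (List.mem_of_mem_head? hi)
  · intro n n' a a' hn hn' h h' heq
    obtain ⟨i, hi⟩ := hhead n a h
    obtain ⟨i', hi'⟩ := hhead n' a' h'
    exact taggedFull_head_injective hn hn' hi hi' (by simpa [hi, hi'] using heq)
  · intro hpop i a ha
    obtain ⟨n, h1, h2, h3⟩ := exists_taggedFull_head hpop ha
    exact ⟨n, h1, h2, by rw [← hq, List.head?_map, h3]; rfl, by simp [h3]⟩

end Fifo

section Queues

variable {P : Type} {α : Type u}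

/-- The form of `exists_queue_source` for a family of queues, one per process. -/
theorem exists_queue_source_family {who : ℕ → P} {q : ℕ → P → List α} {arr : ℕ → Option α}
    {pop : ℕ → Prop} (h0 : ∀ p, q 0 p = [])
    (hne : ∀ n p, who n ≠ p → q (n + 1) p = q n p)
    (hp : ∀ n, pop n → q (n + 1) (who n) = (q n (who n) ++ (arr n).toList).tail)
    (hn : ∀ n, ¬ pop n → q (n + 1) (who n) = q n (who n) ++ (arr n).toList) :
    ∃ src : ℕ → ℕ,
      (∀ n a, pop n → (q n (who n) ++ (arr n).toList).head? = some a →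
        src n ≤ n ∧ who (src n) = who n ∧ arr (src n) = some a) ∧
      (∀ n n' a a', pop n → pop n' → (q n (who n) ++ (arr n).toList).head? = some a →
        (q n' (who n') ++ (arr n').toList).head? = some a' → src n = src n' → n = n') ∧
      (∀ p, (∀ N, ∃ n, N ≤ n ∧ who n = p ∧ pop n) → ∀ i a, who i = p → arr i = some a →
        ∃ n, i ≤ n ∧ who n = p ∧ pop n ∧ (q n (who n) ++ (arr n).toList).head? = some a ∧
          src n = i) := by
  classical
  -- The queue of `p` is a single queue once the arrivals and removals at other processes are
  -- suppressed.
  have key : ∀ p, ∃ src : ℕ → ℕ, _ := fun p =>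
    exists_queue_source (q := fun n => q n p) (arr := fun n => if who n = p then arr n else none)
      (pop := fun n => who n = p ∧ pop n) (h0 p)
      (by rintro n ⟨rfl, h⟩; simpa using hp n h)
      (by
        intro n h
        by_cases hw : who n = p
        · subst hw
          simpa using hn n (fun h' => h ⟨rfl, h'⟩)
        · simpa [hw] using hne n p hw)
  choose src h1 h2 h3 using key
  have h1' : ∀ n a, pop n → (q n (who n) ++ (arr n).toList).head? = some a →
      src (who n) n ≤ n ∧ who (src (who n) n) = who n ∧ arr (src (who n) n) = some a := by
    intro n a hn ha
    have := h1 (who n) n a ⟨rfl, hn⟩ (by simpa using ha)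
    by_cases hw : who (src (who n) n) = who n
    · exact ⟨this.1, hw, by simpa [hw] using this.2⟩
    · simp [hw] at this
  refine ⟨fun n => src (who n) n, h1', ?_, ?_⟩
  · intro n n' a a' hn hn' ha ha' heq
    -- A source lies at the process that removes the entry, so removals with a common source happen
    -- at one process.
    have hw : who n' = who n := by
      rw [← (h1' n a hn ha).2.1, ← (h1' n' a' hn' ha').2.1]
      exact congrArg who heq.symm
    exact h2 (who n) n n' a a' ⟨rfl, hn⟩ ⟨hw, hn'⟩ (by simpa using ha)
      (by simpa [hw] using ha') (by simpa [hw] using heq)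
  · rintro p hpop i a rfl ha
    obtain ⟨n, hin, ⟨hw, hn⟩, h, hs⟩ := h3 (who i) hpop i a (by simpa using ha)
    exact ⟨n, hin, hw, hn, by simpa [hw] using h, by simpa [hw] using hs⟩

end Queues

/-! ### Steps and times in an arbitrary run -/

namespace Run

section General

variable {P : Type} {R I O : Type u} {A : Algorithm P R I O} {D : FailureDetector P R}
  {E : Environment P} (r : Run A D E)

/-- The process that takes the `n`-th step. -/
def who (n : ℕ) : P := (r.S n).proc

/-- As there are finitely many processes, at some time all faulty ones have crashed, and the `n`-th
step is not taken before time `n`. -/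
theorem eventually_who_mem_correct [Finite P] : ∀ᶠ n in atTop, r.who n ∈ r.F.correct := by
  have hm : Monotone r.F.crashed := monotone_nat_of_le_succ r.F.mono
  have : ∀ᶠ n in atTop, ∀ p, p ∉ r.F.correct → p ∈ r.F.crashed n := by
    rw [eventually_all]
    intro p
    by_cases hp : p ∈ r.F.correct
    · simp [hp]
    · obtain ⟨t, ht⟩ := Set.mem_iUnion.1 (not_not.1 hp)
      filter_upwards [eventually_ge_atTop t] with n hn _
      exact hm hn ht
  filter_upwards [this] with n hn
  by_contra h
  exact r.alive n (hm (r.T_strictMono.id_le n) (hn _ h))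

open Classical in
/-- The history in which `X n` happens at the `n`-th step. -/
noncomputable def timed {α : Type u} (X : ℕ → Option α) (p : P) (t : ℕ) : Option α :=
  if h : ∃ n, r.T n = t ∧ r.who n = p then X h.choose else none

theorem timed_T {α : Type u} (X : ℕ → Option α) (n : ℕ) :
    r.timed X (r.who n) (r.T n) = X n := by
  have h : ∃ m, r.T m = r.T n ∧ r.who m = r.who n := ⟨n, rfl, rfl⟩
  rw [timed, dif_pos h, r.T_strictMono.injective h.choose_spec.1]

theorem timed_eq_some {α : Type u} {X : ℕ → Option α} {p : P} {t : ℕ} {a : α} :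
    r.timed X p t = some a ↔ ∃ n, r.T n = t ∧ r.who n = p ∧ X n = some a := by
  constructor
  · intro h
    by_cases hn : ∃ n, r.T n = t ∧ r.who n = p
    · obtain ⟨n, rfl, rfl⟩ := hn
      exact ⟨n, rfl, rfl, by rw [← h, timed_T]⟩
    · rw [timed, dif_neg hn] at h
      cases h
  · rintro ⟨n, rfl, rfl, h⟩
    rw [timed_T, h]

theorem timed_eq_none {α : Type u} (X : ℕ → Option α) {p : P} {t : ℕ}
    (h : ∀ n, ¬ (r.T n = t ∧ r.who n = p)) : r.timed X p t = none := by
  rw [timed, dif_neg (by simpa using h)]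

theorem HI_eq_timed : r.HI = r.timed fun n => (r.S n).stimulus.input? := by
  funext p t
  by_cases h : ∃ n, r.T n = t ∧ r.who n = p
  · obtain ⟨n, rfl, rfl⟩ := h
    rw [timed_T]
    exact r.HI_step n
  · push Not at h
    have h' : ∀ n, ¬ (r.T n = t ∧ r.who n = p) := fun n hn => h n hn.1 hn.2
    rw [timed_eq_none _ _ h', r.HI_none p t h']

theorem HO_eq_timed : r.HO = r.timed fun n => (A.action r.S n).output? := by
  funext p t
  by_cases h : ∃ n, r.T n = t ∧ r.who n = p
  · obtain ⟨n, rfl, rfl⟩ := h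
    rw [timed_T]
    exact r.HO_step n
  · push Not at h
    have h' : ∀ n, ¬ (r.T n = t ∧ r.who n = p) := fun n hn => h n hn.1 hn.2
    rw [timed_eq_none _ _ h', r.HO_none p t h']

theorem exists_T_gt (t : ℕ) : ∃ n, t < r.T n :=
  ⟨t + 1, r.T_strictMono.id_le (t + 1)⟩

open Classical in
/-- The number of steps taken up to and including time `t`. -/
noncomputable def stepsUntil (t : ℕ) : ℕ := Nat.find (r.exists_T_gt t)

/-- The adjunction between times and step numbers through which the two are translated into each
other. -/
theorem lt_stepsUntil_iff {n t : ℕ} : n < r.stepsUntil t ↔ r.T n ≤ t := by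
  classical
  constructor
  · intro h
    exact not_lt.1 (Nat.find_min (r.exists_T_gt t) h)
  · intro h
    have := Nat.find_spec (r.exists_T_gt t)
    exact r.T_strictMono.lt_iff_lt.1 (h.trans_lt this)

theorem stepsUntil_mono : Monotone r.stepsUntil := by
  intro t t' h
  by_contra! hlt
  exact lt_irrefl _ (r.lt_stepsUntil_iff.2 ((r.lt_stepsUntil_iff.1 hlt).trans h))

theorem stepsUntil_T (n : ℕ) : r.stepsUntil (r.T n) = n + 1 := by
  refine le_antisymm ?_ (r.lt_stepsUntil_iff.2 le_rfl)
  by_contra! h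
  exact absurd (r.T_strictMono.le_iff_le.1 (r.lt_stepsUntil_iff.1 h)) (by omega)

theorem eventually_stepsUntil {q : ℕ → Prop} :
    (∀ᶠ t in atTop, q (r.stepsUntil t)) ↔ ∀ᶠ n in atTop, q n := by
  simp only [eventually_atTop]
  constructor
  · rintro ⟨t₀, h⟩
    -- A step number `n + 1` is the value of `stepsUntil` at time `T n`, and `T n ≥ n ≥ t₀`.
    refine ⟨t₀ + 1, fun n hn => ?_⟩
    obtain ⟨n, rfl⟩ := Nat.exists_eq_add_of_le' (show 1 ≤ n by omega)
    rw [← r.stepsUntil_T]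
    exact h _ ((show t₀ ≤ n by omega).trans (r.T_strictMono.id_le n))
  · rintro ⟨N, h⟩
    exact ⟨r.T N, fun t ht => h _ (r.lt_stepsUntil_iff.2 ht).le⟩

/-- The value of an output variable is the value of a local variable that is set to the same
values in the same steps. -/
theorem valueAt_timed {α : Type u} {a : α} {X : ℕ → Option α} {reg : ℕ → P → α}
    (h0 : ∀ p, reg 0 p = a) (hne : ∀ n p, r.who n ≠ p → reg (n + 1) p = reg n p)
    (heq : ∀ n, reg (n + 1) (r.who n) = (X n).getD (reg n (r.who n))) (p : P) (t : ℕ) :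
    valueAt a (r.timed X p) t = reg (r.stepsUntil t) p := by
  -- Here `N` is the number of steps before time `t`. The statement serves both time `0` and the
  -- successor case, since at most step `N` happens at time `t`.
  have hnext : ∀ t N, (∀ n, n < N → r.T n < t) → (∀ n, N ≤ n → t ≤ r.T n) →
      reg (r.stepsUntil t) p = (r.timed X p t).getD (reg N p) := by
    intro t N hN hN'
    by_cases ht : r.T N = t
    · have hs : r.stepsUntil t = N + 1 := by rw [← ht, stepsUntil_T]
      rw [hs]
      by_cases hw : r.who N = p
      · subst hw; subst ht
        rw [heq, timed_T]
      · rw [hne _ _ hw, timed_eq_none, Option.getD_none]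
        rintro n ⟨h1, h2⟩
        have : n = N := r.T_strictMono.injective (h1.trans ht.symm)
        exact hw (this ▸ h2)
    · have hs : r.stepsUntil t = N := by
        refine le_antisymm ?_ ?_
        · by_contra! h
          exact ht (le_antisymm (r.lt_stepsUntil_iff.1 h) (hN' N le_rfl))
        · by_contra! h
          exact absurd (r.lt_stepsUntil_iff.2 (hN _ h).le) (lt_irrefl _)
      rw [hs, timed_eq_none, Option.getD_none]
      rintro n ⟨h1, -⟩
      rcases lt_or_ge n N with h | h
      · exact absurd (hN n h) (by omega)
      · rcases h.lt_or_eq with h | rfl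
        · have := r.T_strictMono h
          have := hN' N le_rfl
          omega
        · exact ht h1
  induction t with
  | zero =>
    rw [hnext 0 0 (by simp) (by simp), h0]
    rfl
  | succ t ih =>
    rw [hnext (t + 1) (r.stepsUntil t)
      (fun n hn => Nat.lt_succ_of_le (r.lt_stepsUntil_iff.1 hn))
      (fun n hn => by
        by_contra! h
        exact absurd (r.lt_stepsUntil_iff.2 (Nat.le_of_lt_succ h)) (by omega)), ← ih]
    rfl

end General

/-! ### Runs of a composed algorithm -/

section Composed

variable {P : Type} {R I O I' O' : Type u} {W : Transformer P I O I' O'} {A : Algorithm P R I O}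
  {D : FailureDetector P R} {E : Environment P} (r : Run (W.apply A) D E)

/-- The stimulus accepted in the `n`-th step. -/
def stim (n : ℕ) : Stimulus (W.Msg ⊕ A.Msg) I' := (r.S n).stimulus

/-- The state of `p` before the `n`-th step. -/
noncomputable def state (n : ℕ) (p : P) : CompState W A := (W.apply A).config r.S n p

/-- The state in which the `n`-th step performs its local job. -/
noncomputable def ready (n : ℕ) : CompState W A :=
  enqueue W A (r.state n (r.who n)) (r.stim n)

/-- The failure-detector value seen in the `n`-th step. -/
def fd (n : ℕ) : R := (r.S n).fd

/-- The state of the transformation at `p` before the `n`-th step. -/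
noncomputable def user (n : ℕ) (p : P) : W.State := (r.state n p).user

/-- The stimulus handled by the transformation in the `n`-th step. -/
noncomputable def userEv (n : ℕ) : Option (Stimulus W.Msg I') := userEvent (r.ready n)

/-- The state of the transformation in the `n`-th step after it has handled its stimulus and before
it handles an output of the black box. -/
noncomputable def mid (n : ℕ) : W.State := userMid (r.who n) (r.ready n)

/-- The stimulus accepted by the black box in the `n`-th step, if it takes a step. -/
noncomputable def boxEv (n : ℕ) : Option (Stimulus A.Msg I) := boxEvent (r.who n) (r.ready n)

/-- The input of the black box in the `n`-th step. -/
noncomputable def boxIn (n : ℕ) : Option I := (r.boxEv n).bind Stimulus.input?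

/-- The output of the black box in the `n`-th step. -/
noncomputable def boxOut (n : ℕ) : Option O := boxOutput (r.who n) (r.ready n) (r.fd n)

/-- The addition to the queue of the transformation in the `n`-th step. -/
def userArrival (n : ℕ) : Option (Stimulus W.Msg I') :=
  match r.stim n with
  | .receive (.inl m) => some (.receive m)
  | .input x => some (.input x)
  | _ => none

/-- The addition to the message queue of the black box in the `n`-th step. -/
def boxArrival (n : ℕ) : Option A.Msg :=
  match r.stim n with
  | .receive (.inr m) => some m
  | _ => none

theorem ready_eq (n : ℕ) :
    r.ready n = { r.state n (r.who n) with
      userQueue := (r.state n (r.who n)).userQueue ++ (r.userArrival n).toList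
      boxQueue := (r.state n (r.who n)).boxQueue ++ (r.boxArrival n).toList } := by
  unfold ready userArrival boxArrival
  rcases h : r.stim n with _ | (m | m) | x <;> simp [enqueue]

theorem state_zero (p : P) : r.state 0 p = ⟨W.init p, A.init p, [], [], 0⟩ := rfl

theorem state_succ_of_ne {n : ℕ} {p : P} (h : r.who n ≠ p) : r.state (n + 1) p = r.state n p := by
  classical
  unfold state
  rw [Algorithm.config]
  exact Function.update_of_ne (Ne.symm h) _ _

theorem state_succ (n : ℕ) :
    r.state (n + 1) (r.who n) =
      { (localStep W A (r.who n) (r.ready n) (r.fd n)).1 with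
        turn := (localStep W A (r.who n) (r.ready n) (r.fd n)).1.turn + 1 } := by
  classical
  unfold state
  rw [Algorithm.config]
  exact Function.update_self _ _ _

theorem action_eq (n : ℕ) :
    (W.apply A).action r.S n = (localStep W A (r.who n) (r.ready n) (r.fd n)).2 := rfl

theorem user_succ_of_ne {n : ℕ} {p : P} (h : r.who n ≠ p) : r.user (n + 1) p = r.user n p := by
  rw [user, state_succ_of_ne _ h, user]

theorem user_succ (n : ℕ) :
    r.user (n + 1) (r.who n) =
      (r.boxOut n).elim (r.mid n) fun y => (W.respond (r.who n) (r.mid n) y).1 := by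
  rw [user, state_succ, localStep_fst]
  rfl

theorem ready_user (n : ℕ) : (r.ready n).user = r.user n (r.who n) := by
  rw [ready_eq]
  rfl

theorem ready_box (n : ℕ) : (r.ready n).box = (r.state n (r.who n)).box := by
  rw [ready_eq]

theorem mid_eq (n : ℕ) :
    r.mid n = (r.userEv n).elim (r.user n (r.who n)) fun e =>
      (W.step (r.who n) (r.user n (r.who n)) e).1 := by
  rw [mid, userMid, ready_user]
  rfl

theorem boxIn_eq_some {n : ℕ} {x : I} :
    r.boxIn n = some x ↔ ∃ e, r.userEv n = some e ∧
      (W.step (r.who n) (r.user n (r.who n)) e).2 = .call x := by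
  rw [← ready_user]
  refine Iff.trans ?_ boxEvent_eq_input_iff
  change (boxEvent (r.who n) (r.ready n)).bind Stimulus.input? = some x ↔ _
  rcases boxEvent (r.who n) (r.ready n) with _ | _ | _ | _ <;> simp [Stimulus.input?]

theorem action_eq_send_inl {n : ℕ} {m : W.Msg} :
    (W.apply A).action r.S n = .send (.inl m) ↔
      (∃ y, r.boxOut n = some y ∧ (W.respond (r.who n) (r.mid n) y).2 = .send m) ∨
        ∃ e, r.userEv n = some e ∧
          (W.step (r.who n) (r.user n (r.who n)) e).2 = .act (.send m) := by
  rw [← ready_user]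
  exact localStep_snd_eq_send_inl_iff

theorem HO_eq_some {p : P} {t : ℕ} {z : O'} :
    r.HO p t = some z ↔ ∃ n, r.T n = t ∧ r.who n = p ∧
      ((∃ y, r.boxOut n = some y ∧ (W.respond (r.who n) (r.mid n) y).2 = .output z) ∨
        ∃ e, r.userEv n = some e ∧
          (W.step (r.who n) (r.user n (r.who n)) e).2 = .act (.output z)) := by
  rw [HO_eq_timed, timed_eq_some]
  refine exists_congr fun n => and_congr_right fun _ => and_congr_right fun _ => ?_
  rw [← ready_user]
  refine Iff.trans ?_ (localStep_snd_eq_output_iff (d := r.fd n))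
  rw [action_eq]
  cases (localStep W A (r.who n) (r.ready n) (r.fd n)).2 <;> simp [Action.output?]

theorem HI_eq_some {p : P} {t : ℕ} {x : I'} :
    r.HI p t = some x ↔ ∃ n, r.T n = t ∧ r.who n = p ∧ r.stim n = .input x := by
  rw [HI_eq_timed, timed_eq_some]
  refine exists_congr fun n => and_congr_right fun _ => and_congr_right fun _ => ?_
  change (r.stim n).input? = some x ↔ _
  cases r.stim n <;> simp [Stimulus.input?]

theorem ready_turn (n : ℕ) : (r.ready n).turn = (r.state n (r.who n)).turn := by
  rw [ready_eq]

/-- Every job of a correct process gets its turn again and again. -/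
theorem exists_ready_turn (hr : r.Admissible) {p : P} (hp : p ∈ r.F.correct) (c : Fin 3)
    (N : ℕ) : ∃ n, N ≤ n ∧ r.who n = p ∧ (r.ready n).turn = c := by
  have hnext : ∀ N, ∃ n, N ≤ n ∧ r.who n = p ∧ (r.state n p).turn = (r.state N p).turn := by
    intro N
    obtain ⟨n, hn, hw⟩ := hr.steps p hp N
    obtain ⟨d, rfl⟩ := Nat.exists_eq_add_of_le hn
    induction d generalizing N with
    | zero => exact ⟨N, le_rfl, hw, rfl⟩
    | succ d ih =>
      by_cases h : r.who N = p
      · exact ⟨N, le_rfl, h, rfl⟩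
      · obtain ⟨n, h1, h2, h3⟩ := ih (N + 1) (by omega) (by convert hw using 3; omega)
        exact ⟨n, by omega, h2, by rw [h3, state_succ_of_ne _ h]⟩
  have hsucc : ∀ N, ∃ n, N ≤ n ∧ r.who n = p ∧ (r.state n p).turn = (r.state N p).turn ∧
      (r.state (n + 1) p).turn = (r.state N p).turn + 1 := by
    intro N
    obtain ⟨n, h1, rfl, h3⟩ := hnext N
    refine ⟨n, h1, rfl, h3, ?_⟩
    rw [state_succ, localStep_fst, ← h3, ← ready_turn]
  -- Three consecutive steps of `p` pass through all three turns.
  have hfin : ∀ t c : Fin 3, c = t ∨ c = t + 1 ∨ c = t + 1 + 1 := by decide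
  obtain ⟨n, h1, h2, h3, h4⟩ := hsucc N
  obtain ⟨n', h1', h2', h3', h4'⟩ := hsucc (n + 1)
  obtain ⟨n'', h1'', h2'', h3'', -⟩ := hsucc (n' + 1)
  simp only [ready_turn]
  rcases hfin (r.state N p).turn c with h | h | h
  · exact ⟨n, h1, h2, by rw [h2, h3, h]⟩
  · exact ⟨n', by omega, h2', by rw [h2', h3', h4, h]⟩
  · exact ⟨n'', by omega, h2'', by rw [h2'', h3'', h4', h4, h]⟩

theorem exists_timeout (hr : r.Admissible) {p : P} (hp : p ∈ r.F.correct) (N : ℕ) :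
    ∃ n, N ≤ n ∧ r.who n = p ∧ r.userEv n = some .empty := by
  obtain ⟨n, h1, h2, h3⟩ := r.exists_ready_turn hr hp 0 N
  exact ⟨n, h1, h2, by simp [userEv, userEvent, h3]⟩

/-- The stimuli handled by the transformation, apart from the timeouts, are those accepted, each
handled at most once, and at a correct process exactly once. -/
theorem exists_user_source : ∃ src : ℕ → ℕ,
    (∀ n e, r.userEv n = some e → e ≠ .empty →
      src n ≤ n ∧ r.who (src n) = r.who n ∧ r.userArrival (src n) = some e) ∧
    (∀ n n' e e', r.userEv n = some e → e ≠ .empty → r.userEv n' = some e' → e' ≠ .empty →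
      src n = src n' → n = n') ∧
    (r.Admissible → ∀ p ∈ r.F.correct, ∀ i e, r.who i = p → r.userArrival i = some e →
      ∃ n, i ≤ n ∧ r.who n = p ∧ r.userEv n = some e ∧ src n = i) := by
  have hrq : ∀ n, (r.ready n).userQueue =
      (r.state n (r.who n)).userQueue ++ (r.userArrival n).toList := by
    intro n
    rw [ready_eq]
  obtain ⟨src, h1, h2, h3⟩ := exists_queue_source_family (who := r.who)
    (q := fun n p => (r.state n p).userQueue) (arr := r.userArrival)
    (pop := fun n => (r.ready n).turn = 1) (fun p => rfl)
    (fun n p h => by simp only [state_succ_of_ne _ h])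
    (fun n h => by simp only [state_succ, localStep_fst, if_pos h, hrq])
    (fun n h => by simp only [state_succ, localStep_fst, if_neg h, hrq])
  simp only [← hrq] at h1 h2 h3
  -- A timeout is the empty stimulus, so any other stimulus was the head of the queue at turn 1.
  have hev : ∀ n e, r.userEv n = some e → e ≠ .empty →
      (r.ready n).turn = 1 ∧ (r.ready n).userQueue.head? = some e := by
    intro n e he hne
    unfold userEv userEvent at he
    split_ifs at he with h h'
    · simp only [Option.some.injEq] at he
      exact absurd he.symm hne
    · exact ⟨h', he⟩
  refine ⟨src, fun n e he hne => h1 n e (hev n e he hne).1 (hev n e he hne).2,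
    fun n n' e e' he hne he' hne' => h2 n n' e e' (hev n e he hne).1 (hev n' e' he' hne').1
      (hev n e he hne).2 (hev n' e' he' hne').2, fun hr p hp i e hi he => ?_⟩
  obtain ⟨n, h4, h5, h6, h7, h8⟩ := h3 p (r.exists_ready_turn hr hp 1) i e hi he
  exact ⟨n, h4, h5, by simp [userEv, userEvent, h6, h7], h8⟩

/-- The analogue of `exists_user_source` for the message queue of the black box, served at turn 2.
Its `src` is what defines the origins in the run of the black box. -/
theorem exists_box_source : ∃ src : ℕ → ℕ,
    (∀ n m, r.boxEv n = some (.receive m) →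
      src n ≤ n ∧ r.who (src n) = r.who n ∧ r.boxArrival (src n) = some m) ∧
    (∀ n n' m m', r.boxEv n = some (.receive m) → r.boxEv n' = some (.receive m') →
      src n = src n' → n = n') ∧
    (r.Admissible → ∀ p ∈ r.F.correct, ∀ i m, r.who i = p → r.boxArrival i = some m →
      ∃ n, i ≤ n ∧ r.who n = p ∧ r.boxEv n = some (.receive m) ∧ src n = i) := by
  have hrq : ∀ n, (r.ready n).boxQueue =
      (r.state n (r.who n)).boxQueue ++ (r.boxArrival n).toList := by
    intro n
    rw [ready_eq]
  obtain ⟨src, h1, h2, h3⟩ := exists_queue_source_family (who := r.who)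
    (q := fun n p => (r.state n p).boxQueue) (arr := r.boxArrival)
    (pop := fun n => (r.ready n).turn = 2) (fun p => rfl)
    (fun n p h => by simp only [state_succ_of_ne _ h])
    (fun n h => by simp only [state_succ, localStep_fst, if_pos h, hrq])
    (fun n h => by simp only [state_succ, localStep_fst, if_neg h, hrq])
  simp only [← hrq] at h1 h2 h3
  refine ⟨src, fun n m hm => ?_, fun n n' m m' hm hm' => ?_, fun hr p hp i m hi hm => ?_⟩
  · obtain ⟨h4, h5⟩ := boxEvent_eq_receive_iff.1 hm
    exact h1 n m h4 h5
  · obtain ⟨h4, h5⟩ := boxEvent_eq_receive_iff.1 hm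
    obtain ⟨h4', h5'⟩ := boxEvent_eq_receive_iff.1 hm'
    exact h2 n n' m m' h4 h4' h5 h5'
  · obtain ⟨n, h4, h5, h6, h7, h8⟩ := h3 p (r.exists_ready_turn hr hp 2) i m hi hm
    exact ⟨n, h4, h5, boxEvent_eq_receive_iff.2 ⟨h6, h7⟩, h8⟩

theorem userArrival_eq_input {n : ℕ} {x : I'} :
    r.userArrival n = some (.input x) ↔ r.stim n = .input x := by
  unfold userArrival
  rcases r.stim n with _ | (_ | _) | _ <;> simp

theorem userArrival_eq_receive {n : ℕ} {m : W.Msg} :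
    r.userArrival n = some (.receive m) ↔ r.stim n = .receive (.inl m) := by
  unfold userArrival
  rcases r.stim n with _ | (_ | _) | _ <;> simp

theorem boxArrival_eq_some {n : ℕ} {m : A.Msg} :
    r.boxArrival n = some m ↔ r.stim n = .receive (.inr m) := by
  unfold boxArrival
  rcases r.stim n with _ | (_ | _) | _ <;> simp

/-! ### The run of the black box inside a run of the composed algorithm -/

/-- The step of the composed algorithm in which the black box takes its `k`-th step. -/
noncomputable def boxIndex (k : ℕ) : ℕ := Nat.nth (fun n => r.boxEv n ≠ none) k

open Classical in
/-- The number of steps taken by the black box before the `n`-th step. -/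
noncomputable def boxCount (n : ℕ) : ℕ := Nat.count (fun n => r.boxEv n ≠ none) n

/-- The schedule of the black box. -/
noncomputable def boxSchedule (k : ℕ) : Step P R A.Msg I :=
  ⟨r.who (r.boxIndex k), (r.boxEv (r.boxIndex k)).getD .empty, r.fd (r.boxIndex k)⟩

theorem boxIndex_boxCount {n : ℕ} (h : r.boxEv n ≠ none) : r.boxIndex (r.boxCount n) = n := by
  classical
  exact Nat.nth_count h

theorem boxIndex_strictMono (h : {n | r.boxEv n ≠ none}.Infinite) : StrictMono r.boxIndex :=
  Nat.nth_strictMono h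

theorem boxEv_boxIndex (h : {n | r.boxEv n ≠ none}.Infinite) (k : ℕ) :
    r.boxEv (r.boxIndex k) = some (r.boxSchedule k).stimulus := by
  have : r.boxEv (r.boxIndex k) ≠ none := Nat.nth_mem_of_infinite h k
  obtain ⟨e, he⟩ := Option.ne_none_iff_exists'.1 this
  simp [boxSchedule, he]

theorem boxCount_boxIndex (h : {n | r.boxEv n ≠ none}.Infinite) (k : ℕ) :
    r.boxCount (r.boxIndex k) = k := by
  classical
  exact Nat.count_nth_of_infinite h k

/-- The state of the black box changes only in steps counted by `boxCount`, and there both sides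
change by the same transition. -/
theorem config_boxSchedule (n : ℕ) (p : P) :
    A.config r.boxSchedule (r.boxCount n) p = (r.state n p).box := by
  classical
  induction n generalizing p with
  | zero => simp [boxCount, Algorithm.config, state_zero]
  | succ n ih =>
    rcases he : r.boxEv n with _ | e
    · have hc : r.boxCount (n + 1) = r.boxCount n := by simp [boxCount, Nat.count_succ, he]
      rw [hc, ih]
      by_cases hp : r.who n = p
      · subst hp
        rw [state_succ, localStep_fst]
        simp only [boxEv] at he
        simp [he, ready_box]
      · rw [state_succ_of_ne _ hp]
    · have hc : r.boxCount (n + 1) = r.boxCount n + 1 := by simp [boxCount, Nat.count_succ, he]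
      have hi : r.boxIndex (r.boxCount n) = n := r.boxIndex_boxCount (by simp [he])
      have hS : r.boxSchedule (r.boxCount n) = ⟨r.who n, e, r.fd n⟩ := by
        simp [boxSchedule, hi, he]
      rw [hc, Algorithm.config, hS]
      by_cases hp : r.who n = p
      · subst hp
        rw [Function.update_self, ih, state_succ, localStep_fst]
        simp only [boxEv] at he
        simp [he, ready_box]
      · rw [Function.update_of_ne (Ne.symm hp), ih, state_succ_of_ne _ hp]

theorem boxAction_boxIndex (h : {n | r.boxEv n ≠ none}.Infinite) (k : ℕ) :
    boxAction (r.who (r.boxIndex k)) (r.ready (r.boxIndex k)) (r.fd (r.boxIndex k)) =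
      some (A.action r.boxSchedule k) := by
  have h1 := r.config_boxSchedule (r.boxIndex k) (r.who (r.boxIndex k))
  rw [boxCount_boxIndex _ h] at h1
  have h2 := r.boxEv_boxIndex h k
  rw [boxEv] at h2
  rw [boxAction, h2, ready_box, ← h1]
  rfl

theorem action_eq_send_inr {n : ℕ} {m : A.Msg} :
    (W.apply A).action r.S n = .send (.inr m) ↔
      boxAction (r.who n) (r.ready n) (r.fd n) = some (.send m) :=
  localStep_snd_eq_send_inr_iff

theorem boxEv_ne_none_of_boxAction {n : ℕ} {a : Action A.Msg O}
    (h : boxAction (r.who n) (r.ready n) (r.fd n) = some a) : r.boxEv n ≠ none := by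
  intro h'
  rw [boxEv] at h'
  simp [boxAction, h'] at h

/-- From some step on only correct processes move, so a correct process exists, and it gets turn 2
again and again. -/
theorem infinite_boxEv [Finite P] (hr : r.Admissible) : {n | r.boxEv n ≠ none}.Infinite := by
  obtain ⟨n₀, h₀⟩ := r.eventually_who_mem_correct.exists
  rw [Set.infinite_iff_exists_gt]
  intro N
  obtain ⟨n, h1, -, h3⟩ := r.exists_ready_turn hr h₀ 2 (N + 1)
  exact ⟨n, by simp [boxEv, boxEvent, h3], h1⟩

/-- In an admissible run of the composed algorithm the black box takes an admissible run. -/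
theorem exists_boxRun [Finite P] (hr : r.Admissible) :
    ∃ r' : Run A D E, r'.Admissible ∧ r'.F = r.F ∧ r'.HI = r.timed r.boxIn ∧
      r'.HO = r.timed r.boxOut := by
  have hinf := r.infinite_boxEv hr
  obtain ⟨src, hs1, hs2, hs3⟩ := r.exists_box_source
  have hev := r.boxEv_boxIndex hinf
  have hact := r.boxAction_boxIndex hinf
  -- Trace a message back from its removal from the queue to its arrival, and from there to its
  -- sending; the tag `inr` shows that the sending was a step of the black box, so it has a number
  -- in the new schedule.
  have horig : ∀ k m, (r.boxSchedule k).stimulus = .receive m →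
      r.origin (src (r.boxIndex k)) < r.boxIndex k ∧
      r.who (src (r.boxIndex k)) = r.who (r.boxIndex k) ∧
      r.stim (src (r.boxIndex k)) = .receive (.inr m) ∧
      r.boxIndex (r.boxCount (r.origin (src (r.boxIndex k)))) =
        r.origin (src (r.boxIndex k)) ∧
      A.action r.boxSchedule (r.boxCount (r.origin (src (r.boxIndex k)))) = .send m := by
    intro k m h
    obtain ⟨h1, h2, h3⟩ := hs1 (r.boxIndex k) m (by rw [hev, h])
    rw [boxArrival_eq_some] at h3
    obtain ⟨h4, h5⟩ := r.receive_origin _ _ h3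
    rw [action_eq_send_inr] at h5
    have h6 := r.boxIndex_boxCount (r.boxEv_ne_none_of_boxAction h5)
    refine ⟨h4.trans_le h1, h2, h3, h6, ?_⟩
    have h7 := hact (r.boxCount (r.origin (src (r.boxIndex k))))
    rw [h6, h5, Option.some.injEq] at h7
    exact h7.symm
  refine ⟨{ F := r.F, H := r.H, HI := r.timed r.boxIn, HO := r.timed r.boxOut
            S := r.boxSchedule, T := fun k => r.T (r.boxIndex k)
            origin := fun k => r.boxCount (r.origin (src (r.boxIndex k)))
            F_mem := r.F_mem, H_mem := r.H_mem
            T_strictMono := r.T_strictMono.comp (r.boxIndex_strictMono hinf)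
            alive := fun k => r.alive (r.boxIndex k)
            fd_eq := fun k => r.fd_eq (r.boxIndex k)
            receive_origin := ?_, receive_once := ?_, HI_step := ?_, HI_none := ?_
            HO_step := ?_, HO_none := ?_ }, ⟨?_, ?_⟩, rfl, rfl, rfl⟩
  · intro k m h
    obtain ⟨h1, -, -, h4, h5⟩ := horig k m h
    exact ⟨(r.boxIndex_strictMono hinf).lt_iff_lt.1 (h4.symm ▸ h1), h5⟩
  · intro k k' m m' h h' hp ho
    obtain ⟨-, h2, h3, h4, -⟩ := horig k m h
    obtain ⟨-, h2', h3', h4', -⟩ := horig k' m' h'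
    -- Equal origins give equal arrivals by `receive_once` for the composed run, and equal arrivals
    -- give equal removals by injectivity of `src`.
    refine (r.boxIndex_strictMono hinf).injective
      (hs2 _ _ m m' (by rw [hev, h]) (by rw [hev, h']) ?_)
    refine r.receive_once _ _ _ _ h3 h3' (h2.trans (Eq.trans hp h2'.symm)) ?_
    rw [← h4, ← h4']
    exact congrArg _ ho
  · intro k
    rw [show (r.boxSchedule k).proc = r.who (r.boxIndex k) from rfl, timed_T, boxIn, hev]
    rfl
  · intro p t h
    rw [Option.eq_none_iff_forall_ne_some]
    intro x hx
    obtain ⟨n, h1, h2, h3⟩ := r.timed_eq_some.1 hx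
    have hn := r.boxIndex_boxCount (n := n) (by intro h'; simp [boxIn, h'] at h3)
    exact h (r.boxCount n) ⟨by simp only [hn, h1], by simp only [boxSchedule, hn, h2]⟩
  · intro k
    rw [show (r.boxSchedule k).proc = r.who (r.boxIndex k) from rfl, timed_T, boxOut, boxOutput,
      hact]
    rfl
  · intro p t h
    rw [Option.eq_none_iff_forall_ne_some]
    intro y hy
    obtain ⟨n, h1, h2, h3⟩ := r.timed_eq_some.1 hy
    have hn := r.boxIndex_boxCount (r.boxEv_ne_none_of_boxAction (boxOutput_eq_some.1 h3))
    exact h (r.boxCount n) ⟨by simp only [hn, h1], by simp only [boxSchedule, hn, h2]⟩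
  · intro p hp N
    obtain ⟨n, h1, h2, h3⟩ := r.exists_ready_turn hr hp 2 (r.boxIndex N)
    have hn := r.boxIndex_boxCount (n := n) (by simp [boxEv, boxEvent, h3])
    exact ⟨r.boxCount n, (r.boxIndex_strictMono hinf).le_iff_le.1 (hn.symm ▸ h1),
      by simp only [boxSchedule, hn, h2]⟩
  · intro k m h p hp
    have h1 := hact k
    simp only at h
    rw [h, ← action_eq_send_inr] at h1
    obtain ⟨i, h2, h3, h4⟩ := hr.messages _ _ h1 p hp
    obtain ⟨n, -, h6, h7, h8⟩ := hs3 hr p hp i m h2 (r.boxArrival_eq_some.2 h3)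
    have hn := r.boxIndex_boxCount (n := n) (by simp [h7])
    refine ⟨r.boxCount n, by simp only [boxSchedule, hn, h6], ?_, ?_⟩
    · simp [boxSchedule, hn, h7]
    · simp only [hn, h8, h4, boxCount_boxIndex _ hinf]

/-- The only point at which the assumption on the black box enters. -/
theorem box_acceptable [Finite P] (hr : r.Admissible) {Q : Problem P I O} (hA : Solves A D E Q) :
    Q r.F (r.timed r.boxIn) (r.timed r.boxOut) := by
  obtain ⟨r', h1, h2, h3, h4⟩ := r.exists_boxRun hr
  simpa only [h2, h3, h4] using hA r' h1

end Composed

end Run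

/-! ### From EC to ETOB -/

/-- The last instance of EC to which the process has received the response. -/
def ECToETOBState.level {M : Type u} (s : ECToETOBState M) : ℕ :=
  if s.pending then s.count - 1 else s.count

theorem mem_newBatch {M : Type u} {d : List M} {toDeliver : Finset M} {m : M} :
    m ∈ newBatch d toDeliver ↔ m ∈ toDeliver ∧ m ∉ d := by
  classical
  simp [newBatch]

theorem nodup_append_newBatch {M : Type u} {d : List M} (h : d.Nodup) (toDeliver : Finset M) :
    (d ++ newBatch d toDeliver).Nodup := by
  classical
  rw [List.nodup_append']
  refine ⟨h, Finset.nodup_toList _, fun m hm hm' => (mem_newBatch.1 hm').2 hm⟩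

/-- The sequence coded by a value. -/
noncomputable def decodeList {M V : Type u} (enc : List M ↪ V) (v : V) : List M :=
  (Function.partialInv enc v).getD []

theorem decodeList_enc {M V : Type u} (enc : List M ↪ V) (l : List M) :
    decodeList enc (enc l) = l := by
  simp [decodeList, Function.partialInv_left enc.injective]

open Classical in
/-- The steps of the transformation from EC to ETOB. -/
noncomputable def ecToETOBStep {M V : Type u} (enc : List M ↪ V) (s : ECToETOBState M) :
    Stimulus M M → ECToETOBState M × Command M (ℕ × V) (List M)
  | .input m => (s, .act (.send m))
  | .receive m => ({ s with toDeliver := insert m s.toDeliver }, .act .idle)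
  | .empty =>
      if s.pending then (s, .act .idle)
      else ({ s with count := s.count + 1, pending := true },
        .call (s.count + 1, enc (s.d ++ newBatch s.d s.toDeliver)))

/-- The reaction of the transformation from EC to ETOB to a response. -/
noncomputable def ecToETOBRespond {M V : Type u} (enc : List M ↪ V) (s : ECToETOBState M)
    (y : ℕ × V) : ECToETOBState M × Action M (List M) :=
  if s.pending = true ∧ y.1 = s.count then
    ({ s with d := decodeList enc y.2, pending := false }, .output (decodeList enc y.2))
  else (s, .idle)

theorem ecToETOB_step {P : Type} {M V : Type u} (enc : List M ↪ V) (p : P) (s : ECToETOBState M)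
    (e : Stimulus M M) : (ecToETOB P enc).step p s e = ecToETOBStep enc s e := by
  cases e <;> rfl

namespace Run

section ECToETOB

variable {P : Type} {M V R : Type u} {enc : List M ↪ V} {A : Algorithm P R (ℕ × V) (ℕ × V)}
  {D : FailureDetector P R} {E : Environment P} (r : Run ((ecToETOB P enc).apply A) D E)

noncomputable def ecState (n : ℕ) (p : P) : ECToETOBState M := r.user n p

/-- The stimulus handled by the transformation in the `n`-th step. -/
noncomputable def ecEv (n : ℕ) : Option (Stimulus M M) := r.userEv n

noncomputable def ecMid (n : ℕ) : ECToETOBState M := r.mid n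

/-- The sequence that the `n`-th step proposes if it proposes one. -/
noncomputable def proposal (n : ℕ) : List M :=
  (r.ecState n (r.who n)).d ++
    newBatch (r.ecState n (r.who n)).d (r.ecState n (r.who n)).toDeliver

/-- The response to the pending instance in the `n`-th step. -/
noncomputable def ecAccepted (n : ℕ) : Option (ℕ × V) :=
  (r.boxOut n).filter fun y => (r.ecMid n).pending && y.1 == (r.ecMid n).count

theorem ecAccepted_eq_some {n : ℕ} {y : ℕ × V} :
    r.ecAccepted n = some y ↔
      r.boxOut n = some y ∧ (r.ecMid n).pending = true ∧ y.1 = (r.ecMid n).count := by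
  simp [ecAccepted, Option.filter_eq_some_iff]

theorem ecMid_eq (n : ℕ) :
    r.ecMid n = (r.ecEv n).elim (r.ecState n (r.who n)) fun e =>
      (ecToETOBStep enc (r.ecState n (r.who n)) e).1 := by
  simp only [← ecToETOB_step (P := P) enc (r.who n)]
  exact r.mid_eq n

theorem ec_boxIn_eq_some {n : ℕ} {x : ℕ × V} :
    r.boxIn n = some x ↔ r.ecEv n = some .empty ∧ (r.ecState n (r.who n)).pending = false ∧
      x = ((r.ecState n (r.who n)).count + 1, enc (r.proposal n)) := by
  have h : r.boxIn n = some x ↔ ∃ e, r.ecEv n = some e ∧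
      (ecToETOBStep enc (r.ecState n (r.who n)) e).2 = .call x := by
    simp only [← ecToETOB_step (P := P) enc (r.who n)]
    exact r.boxIn_eq_some
  rw [h]
  constructor
  · rintro ⟨_ | m | m, he, h⟩
    · cases hp : (r.ecState n (r.who n)).pending
      · simp only [ecToETOBStep, hp, Bool.false_eq_true, if_false, Command.call.injEq] at h
        exact ⟨he, rfl, h.symm⟩
      · simp [ecToETOBStep, hp] at h
    · cases h
    · cases h
  · rintro ⟨h1, h2, rfl⟩
    exact ⟨_, h1, by simp [ecToETOBStep, h2, proposal]⟩

theorem ecMid_d (n : ℕ) : (r.ecMid n).d = (r.ecState n (r.who n)).d := by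
  rw [ecMid_eq]
  rcases r.ecEv n with _ | _ | _ | _
  · rfl
  · simp only [ecToETOBStep, Option.elim]
    split_ifs <;> rfl
  · rfl
  · rfl

theorem mem_ecMid_toDeliver {n : ℕ} {m : M} : m ∈ (r.ecMid n).toDeliver ↔
    m ∈ (r.ecState n (r.who n)).toDeliver ∨ r.ecEv n = some (.receive m) := by
  rw [ecMid_eq]
  rcases r.ecEv n with _ | _ | m' | _
  · simp
  · simp only [ecToETOBStep, Option.elim]
    split_ifs <;> simp
  · simp only [ecToETOBStep, Option.elim, Finset.mem_insert, Option.some.injEq,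
      Stimulus.receive.injEq]
    rw [or_comm, eq_comm]
  · simp [ecToETOBStep]

/-- The inductions on `count` and `pending` rest on this dichotomy: a step either proposes to the
next instance or leaves both alone. -/
theorem ecMid_cases (n : ℕ) :
    (r.boxIn n = none ∧ (r.ecMid n).count = (r.ecState n (r.who n)).count ∧
      (r.ecMid n).pending = (r.ecState n (r.who n)).pending) ∨
    (r.boxIn n = some ((r.ecState n (r.who n)).count + 1, enc (r.proposal n)) ∧
      (r.ecState n (r.who n)).pending = false ∧
      (r.ecMid n).count = (r.ecState n (r.who n)).count + 1 ∧ (r.ecMid n).pending = true) := by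
  rcases h : r.boxIn n with _ | x
  · left
    refine ⟨rfl, ?_⟩
    rw [ecMid_eq]
    rcases he : r.ecEv n with _ | _ | _ | _
    · simp
    · cases hp : (r.ecState n (r.who n)).pending
      · rw [r.ec_boxIn_eq_some.2 ⟨he, hp, rfl⟩] at h
        cases h
      · simp [ecToETOBStep, hp]
    · simp [ecToETOBStep]
    · simp [ecToETOBStep]
  · right
    obtain ⟨h1, h2, rfl⟩ := r.ec_boxIn_eq_some.1 h
    refine ⟨rfl, h2, ?_⟩
    rw [ecMid_eq, h1]
    simp [ecToETOBStep, h2]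

theorem ecState_succ_of_ne {n : ℕ} {p : P} (h : r.who n ≠ p) :
    r.ecState (n + 1) p = r.ecState n p := r.user_succ_of_ne h

theorem ecState_succ (n : ℕ) :
    r.ecState (n + 1) (r.who n) = (r.ecAccepted n).elim (r.ecMid n) fun y =>
      { r.ecMid n with d := decodeList enc y.2, pending := false } := by
  have h : r.ecState (n + 1) (r.who n) =
      (r.boxOut n).elim (r.ecMid n) fun y => (ecToETOBRespond enc (r.ecMid n) y).1 :=
    r.user_succ n
  rw [h]
  rcases h : r.boxOut n with _ | y
  · simp [ecAccepted, h]
  · by_cases hy : (r.ecMid n).pending = true ∧ y.1 = (r.ecMid n).count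
    · rw [r.ecAccepted_eq_some.2 ⟨h, hy⟩]
      simp only [Option.elim, ecToETOBRespond, if_pos hy]
    · have : r.ecAccepted n = none := by
        rw [Option.eq_none_iff_forall_ne_some]
        intro y' hy'
        obtain ⟨h1, h2⟩ := r.ecAccepted_eq_some.1 hy'
        rw [h, Option.some.injEq] at h1
        exact hy (h1 ▸ h2)
      rw [this]
      simp only [Option.elim, ecToETOBRespond, if_neg hy]

theorem ecState_zero (p : P) : r.ecState 0 p = ⟨[], ∅, 0, false⟩ := rfl

theorem ec_HO : r.HO = r.timed fun n => (r.ecAccepted n).map fun y => decodeList enc y.2 := by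
  have h : ∀ {p t l}, r.HO p t = some l ↔ ∃ n, r.T n = t ∧ r.who n = p ∧
      ((∃ y, r.boxOut n = some y ∧ (ecToETOBRespond enc (r.ecMid n) y).2 = .output l) ∨
        ∃ e, r.ecEv n = some e ∧
          (ecToETOBStep enc (r.ecState n (r.who n)) e).2 = .act (.output l)) := by
    intro p t l
    refine r.HO_eq_some.trans (exists_congr fun n => ?_)
    simp only [← ecToETOB_step (P := P) enc (r.who n)]
    rfl
  funext p t
  refine Option.ext fun l => ?_
  rw [h, timed_eq_some]
  refine exists_congr fun n => and_congr_right fun _ => and_congr_right fun _ => ?_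
  rw [Option.map_eq_some_iff]
  constructor
  · rintro (⟨y, h1, h2⟩ | ⟨_ | _ | _, h1, h2⟩)
    · by_cases hy : (r.ecMid n).pending = true ∧ y.1 = (r.ecMid n).count
      · simp only [ecToETOBRespond, if_pos hy, Action.output.injEq] at h2
        exact ⟨y, r.ecAccepted_eq_some.2 ⟨h1, hy⟩, h2⟩
      · simp [ecToETOBRespond, if_neg hy] at h2
    · simp only [ecToETOBStep] at h2
      split_ifs at h2
      simp at h2
    · simp [ecToETOBStep] at h2
    · simp [ecToETOBStep] at h2
  · rintro ⟨y, h1, rfl⟩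
    obtain ⟨h2, h3⟩ := r.ecAccepted_eq_some.1 h1
    exact .inl ⟨y, h2, by simp only [ecToETOBRespond, if_pos h3]⟩

theorem ec_action_eq_send {n : ℕ} {m : M} :
    ((ecToETOB P enc).apply A).action r.S n = .send (.inl m) ↔ r.ecEv n = some (.input m) := by
  have h : ((ecToETOB P enc).apply A).action r.S n = .send (.inl m) ↔
      (∃ y, r.boxOut n = some y ∧ (ecToETOBRespond enc (r.ecMid n) y).2 = .send m) ∨
        ∃ e, r.ecEv n = some e ∧
          (ecToETOBStep enc (r.ecState n (r.who n)) e).2 = .act (.send m) := by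
    simp only [← ecToETOB_step (P := P) enc (r.who n)]
    exact r.action_eq_send_inl
  rw [h]
  refine ⟨?_, fun h => .inr ⟨_, h, rfl⟩⟩
  rintro (⟨y, h1, h2⟩ | ⟨_ | _ | m', h1, h2⟩)
  · simp only [ecToETOBRespond] at h2
    split_ifs at h2
  · simp only [ecToETOBStep] at h2
    split_ifs at h2
    simp at h2
  · simp [ecToETOBStep] at h2
  · simp only [ecToETOBStep, Command.act.injEq, Action.send.injEq] at h2
    rw [h1, h2]

/-- Calls are handled after they are accepted, and pushes after they are received. -/
theorem exists_ec_source (r : Run ((ecToETOB P enc).apply A) D E) : ∃ src : ℕ → ℕ,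
    (∀ n m, r.ecEv n = some (.input m) → src n ≤ n ∧ r.stim (src n) = .input m) ∧
    (∀ n m, r.ecEv n = some (.receive m) → src n ≤ n ∧
      r.stim (src n) = .receive (.inl m)) ∧
    (r.Admissible → ∀ p ∈ r.F.correct, ∀ i m, r.who i = p → r.stim i = .input m →
      ∃ n, r.who n = p ∧ r.ecEv n = some (.input m)) ∧
    (r.Admissible → ∀ p ∈ r.F.correct, ∀ i m, r.who i = p → r.stim i = .receive (.inl m) →
      ∃ n, r.who n = p ∧ r.ecEv n = some (.receive m)) := by
  obtain ⟨src, h1, -, h2⟩ := r.exists_user_source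
  refine ⟨src, fun n m h => ?_, fun n m h => ?_, fun hr p hp i m hi h => ?_,
    fun hr p hp i m hi h => ?_⟩
  · obtain ⟨h3, -, h4⟩ := h1 n _ h nofun
    exact ⟨h3, r.userArrival_eq_input.1 h4⟩
  · obtain ⟨h3, -, h4⟩ := h1 n _ h nofun
    exact ⟨h3, r.userArrival_eq_receive.1 h4⟩
  · obtain ⟨n, -, h3, h4, -⟩ := h2 hr p hp i _ hi (r.userArrival_eq_input.2 h)
    exact ⟨n, h3, h4⟩
  · obtain ⟨n, -, h3, h4, -⟩ := h2 hr p hp i _ hi (r.userArrival_eq_receive.2 h)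
    exact ⟨n, h3, h4⟩

theorem valueAt_ec_HO (p : P) (t : ℕ) :
    valueAt [] (r.HO p) t = (r.ecState (r.stepsUntil t) p).d := by
  rw [ec_HO]
  refine r.valueAt_timed (reg := fun n p => (r.ecState n p).d) (fun p => rfl)
    (fun n p h => by simp only [r.ecState_succ_of_ne h]) (fun n => ?_) p t
  rw [ecState_succ]
  cases r.ecAccepted n
  · simp [ecMid_d]
  · rfl

theorem ecState_succ_count (n : ℕ) : (r.ecState (n + 1) (r.who n)).count = (r.ecMid n).count := by
  rw [ecState_succ]
  cases r.ecAccepted n <;> rfl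

theorem ecState_succ_toDeliver (n : ℕ) :
    (r.ecState (n + 1) (r.who n)).toDeliver = (r.ecMid n).toDeliver := by
  rw [ecState_succ]
  cases r.ecAccepted n <;> rfl

theorem ecState_succ_of_none {n : ℕ} (h : r.ecAccepted n = none) :
    r.ecState (n + 1) (r.who n) = r.ecMid n := by
  rw [ecState_succ, h]
  rfl

theorem ecState_succ_of_some {n : ℕ} {y : ℕ × V} (h : r.ecAccepted n = some y) :
    r.ecState (n + 1) (r.who n) =
      { r.ecMid n with d := decodeList enc y.2, pending := false } := by
  rw [ecState_succ, h]
  rfl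

/-- `pending` is set only together with an increment of `count`. This makes the truncated
subtraction in `ECToETOBState.level` harmless. -/
theorem ec_count_pos {n : ℕ} {p : P} (h : (r.ecState n p).pending = true) :
    0 < (r.ecState n p).count := by
  induction n with
  | zero => simp [ecState_zero] at h
  | succ n ih =>
    by_cases hp : r.who n = p
    · subst hp
      rcases ha : r.ecAccepted n with _ | y
      · rw [r.ecState_succ_of_none ha] at h ⊢
        rcases r.ecMid_cases n with ⟨-, h1, h2⟩ | ⟨-, -, h1, -⟩
        · rw [h1]
          exact ih (h2 ▸ h)
        · omega
      · rw [r.ecState_succ_of_some ha] at h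
        simp at h
    · rw [r.ecState_succ_of_ne hp] at h ⊢
      exact ih h

theorem ecMid_count_pos {n : ℕ} (h : (r.ecMid n).pending = true) : 0 < (r.ecMid n).count := by
  rcases r.ecMid_cases n with ⟨-, h1, h2⟩ | ⟨-, -, h1, -⟩
  · rw [h1]
    exact r.ec_count_pos (h2 ▸ h)
  · omega

theorem ecMid_level (n : ℕ) : (r.ecMid n).level = (r.ecState n (r.who n)).level := by
  unfold ECToETOBState.level
  rcases r.ecMid_cases n with ⟨-, h1, h2⟩ | ⟨-, h0, h1, h2⟩
  · rw [h1, h2]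
  · simp [h0, h1, h2]

theorem ec_level_succ_of_none {n : ℕ} (h : r.ecAccepted n = none) :
    (r.ecState (n + 1) (r.who n)).level = (r.ecState n (r.who n)).level := by
  rw [r.ecState_succ_of_none h, ecMid_level]

theorem ec_level_succ_of_some {n : ℕ} {y : ℕ × V} (h : r.ecAccepted n = some y) :
    (r.ecState (n + 1) (r.who n)).level = y.1 ∧
      (r.ecState n (r.who n)).level + 1 = y.1 := by
  obtain ⟨-, h2, h3⟩ := r.ecAccepted_eq_some.1 h
  have := r.ecMid_count_pos h2
  rw [r.ecState_succ_of_some h, ← ecMid_level]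
  simp only [ECToETOBState.level, h2, h3]
  refine ⟨by simp, by simp; omega⟩

theorem ec_level_mono (p : P) : Monotone fun n => (r.ecState n p).level := by
  refine monotone_nat_of_le_succ fun n => ?_
  by_cases hp : r.who n = p
  · subst hp
    rcases ha : r.ecAccepted n with _ | y
    · exact (r.ec_level_succ_of_none ha).ge
    · have := r.ec_level_succ_of_some ha
      omega
  · simp only [r.ecState_succ_of_ne hp, le_refl]

theorem ec_count_mono (p : P) : Monotone fun n => (r.ecState n p).count := by
  refine monotone_nat_of_le_succ fun n => ?_
  by_cases hp : r.who n = p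
  · subst hp
    rw [ecState_succ_count]
    rcases r.ecMid_cases n with ⟨-, h1, -⟩ | ⟨-, -, h1, -⟩ <;> omega
  · simp only [r.ecState_succ_of_ne hp, le_refl]

theorem ec_toDeliver_mono (p : P) : Monotone fun n => (r.ecState n p).toDeliver := by
  refine monotone_nat_of_le_succ fun n => ?_
  by_cases hp : r.who n = p
  · subst hp
    rw [ecState_succ_toDeliver]
    exact fun m hm => r.mem_ecMid_toDeliver.2 (.inl hm)
  · simp only [r.ecState_succ_of_ne hp, le_refl]

theorem ec_count_succ_of_boxIn {n j : ℕ} {v : V} (h : r.boxIn n = some (j, v)) :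
    (r.ecState n (r.who n)).count + 1 = j ∧ (r.ecMid n).count = j ∧
      (r.ecState (n + 1) (r.who n)).count = j := by
  rw [ecState_succ_count]
  rcases r.ecMid_cases n with ⟨h1, -⟩ | ⟨h1, -, h2, -⟩
  · rw [h] at h1
    cases h1
  · rw [h, Option.some.injEq, Prod.mk.injEq] at h1
    omega

/-- The invocation may belong to step `n` itself, whose response can follow within the same step;
hence `i ≤ n`. The premise `ih` is explicit so that the lemma can be used inside the induction below
as well as after it. -/
theorem exists_boxIn_of_le_ecMid_count {n j : ℕ}
    (ih : ∀ j, 1 ≤ j → j ≤ (r.ecState n (r.who n)).count →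
      ∃ i < n, r.who i = r.who n ∧ ∃ x, r.boxIn i = some (j, x))
    (h1 : 1 ≤ j) (h : j ≤ (r.ecMid n).count) :
    ∃ i ≤ n, r.who i = r.who n ∧ ∃ x, r.boxIn i = some (j, x) := by
  rcases r.ecMid_cases n with ⟨-, h2, -⟩ | ⟨h2, -, h3, -⟩
  · obtain ⟨i, hi, h⟩ := ih j h1 (h2 ▸ h)
    exact ⟨i, hi.le, h⟩
  · rcases h.lt_or_eq with h | rfl
    · obtain ⟨i, hi, h⟩ := ih j h1 (by omega)
      exact ⟨i, hi.le, h⟩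
    · exact ⟨n, le_rfl, rfl, _, by rw [h2, h3]⟩

theorem exists_boxIn_of_le_count {n j : ℕ} {p : P} (h1 : 1 ≤ j)
    (h : j ≤ (r.ecState n p).count) :
    ∃ i < n, r.who i = p ∧ ∃ x, r.boxIn i = some (j, x) := by
  induction n generalizing j p with
  | zero =>
    simp only [ecState_zero] at h
    omega
  | succ n ih =>
    by_cases hp : r.who n = p
    · subst hp
      rw [ecState_succ_count] at h
      obtain ⟨i, hi, h⟩ := r.exists_boxIn_of_le_ecMid_count (fun j => ih) h1 h
      exact ⟨i, by omega, h⟩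
    · rw [r.ecState_succ_of_ne hp] at h
      obtain ⟨i, hi, h⟩ := ih h1 h
      exact ⟨i, by omega, h⟩

/-- The level rises only by one at a time, by accepting a response to the pending instance, so no
instance up to the level is skipped. -/
theorem exists_boxOut_of_le_level {n j : ℕ} {p : P} (h1 : 1 ≤ j)
    (h : j ≤ (r.ecState n p).level) :
    ∃ i₁ i₂, i₁ ≤ i₂ ∧ i₂ < n ∧ r.who i₁ = p ∧ r.who i₂ = p ∧
      (∃ x, r.boxIn i₁ = some (j, x)) ∧ ∃ y, r.boxOut i₂ = some (j, y) := by
  induction n generalizing j p with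
  | zero =>
    simp only [ecState_zero, ECToETOBState.level] at h
    simp only [Bool.false_eq_true, if_false] at h
    omega
  | succ n ih =>
    have hlift : ∀ {j p}, 1 ≤ j → j ≤ (r.ecState n p).level →
        ∃ i₁ i₂, i₁ ≤ i₂ ∧ i₂ < n + 1 ∧ r.who i₁ = p ∧ r.who i₂ = p ∧
          (∃ x, r.boxIn i₁ = some (j, x)) ∧ ∃ y, r.boxOut i₂ = some (j, y) := by
      intro j p h1 h
      obtain ⟨i₁, i₂, h2, h3, h4⟩ := ih h1 h
      exact ⟨i₁, i₂, h2, by omega, h4⟩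
    by_cases hp : r.who n = p
    · subst hp
      rcases ha : r.ecAccepted n with _ | ⟨j', y⟩
      · exact hlift h1 ((r.ec_level_succ_of_none ha) ▸ h)
      · obtain ⟨h2, h3⟩ := r.ec_level_succ_of_some ha
        obtain ⟨h4, -, h5⟩ := r.ecAccepted_eq_some.1 ha
        simp only at h2 h3 h5
        rcases (h2 ▸ h).lt_or_eq with h | rfl
        · exact hlift h1 (by omega)
        · obtain ⟨i, hi, h6, h7⟩ := r.exists_boxIn_of_le_ecMid_count
            (fun j => r.exists_boxIn_of_le_count) h1 h5.le
          exact ⟨i, n, hi, n.lt_succ_self, h6, rfl, h7, y, h4⟩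
    · exact hlift h1 ((r.ecState_succ_of_ne hp) ▸ h)

theorem ec_level_le_count (n : ℕ) (p : P) :
    (r.ecState n p).level ≤ (r.ecState n p).count := by
  unfold ECToETOBState.level
  split_ifs <;> omega

/-- A correct process that has the response to instance `j` invokes the next instance. -/
theorem exists_lt_count (hr : r.Admissible) {p : P} (hp : p ∈ r.F.correct) {N j : ℕ}
    (h : j ≤ (r.ecState N p).level) : ∃ n, j < (r.ecState n p).count := by
  obtain ⟨n, h1, rfl, h3⟩ := r.exists_timeout hr hp N
  have h4 : j ≤ (r.ecState n (r.who n)).level := h.trans (r.ec_level_mono _ h1)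
  cases hpe : (r.ecState n (r.who n)).pending
  · have h5 := r.ec_count_succ_of_boxIn (r.ec_boxIn_eq_some.2 ⟨h3, hpe, rfl⟩)
    have := r.ec_level_le_count n (r.who n)
    exact ⟨n + 1, by omega⟩
  · have := r.ec_count_pos hpe
    simp only [ECToETOBState.level, hpe, if_true] at h4
    exact ⟨n, by omega⟩

/-- The transformation meets the assumption of EC on its application. -/
theorem ecInputs (hr : r.Admissible) :
    ECInputs r.F (r.timed r.boxIn) (r.timed r.boxOut) where
  pos p t j v h := by
    obtain ⟨n, -, -, hx⟩ := r.timed_eq_some.1 h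
    have := r.ec_count_succ_of_boxIn hx
    omega
  once p j t t' v v' h h' := by
    obtain ⟨n, rfl, rfl, hx⟩ := r.timed_eq_some.1 h
    obtain ⟨n', rfl, hw, hx'⟩ := r.timed_eq_some.1 h'
    have h1 := r.ec_count_succ_of_boxIn hx
    have h1' := r.ec_count_succ_of_boxIn hx'
    rw [hw] at h1'
    rcases lt_trichotomy n n' with hlt | rfl | hlt
    · have : (r.ecState (n + 1) (r.who n)).count ≤ (r.ecState n' (r.who n)).count :=
        r.ec_count_mono _ hlt
      omega
    · rfl
    · have : (r.ecState (n' + 1) (r.who n)).count ≤ (r.ecState n (r.who n)).count :=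
        r.ec_count_mono _ hlt
      omega
  order p j t v hj h := by
    obtain ⟨n, rfl, rfl, hn⟩ := r.timed_eq_some.1 h
    have h1 := r.ec_count_succ_of_boxIn hn
    obtain ⟨-, h2, -⟩ := r.ec_boxIn_eq_some.1 hn
    obtain ⟨i₁, i₂, h3, h4, h5, h6, ⟨x, hx⟩, y, hy⟩ :=
      r.exists_boxOut_of_le_level (n := n) (p := r.who n) hj
        (by simp only [ECToETOBState.level, h2]; simp; omega)
    exact ⟨r.T i₁, r.T i₂, r.T_strictMono.monotone h3, r.T_strictMono h4,
      ⟨x, r.timed_eq_some.2 ⟨i₁, rfl, h5, hx⟩⟩, y, r.timed_eq_some.2 ⟨i₂, rfl, h6, hy⟩⟩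
  first p hp := by
    obtain ⟨n, h⟩ := r.exists_lt_count hr hp (N := 0) (Nat.zero_le _)
    obtain ⟨i, -, h1, x, hx⟩ := r.exists_boxIn_of_le_count le_rfl h
    exact ⟨r.T i, x, r.timed_eq_some.2 ⟨i, rfl, h1, hx⟩⟩
  next p hp j t₁ t₂ x y hle h h' := by
    obtain ⟨n₁, rfl, rfl, hn⟩ := r.timed_eq_some.1 h
    obtain ⟨n₂, rfl, hw, hn'⟩ := r.timed_eq_some.1 h'
    have hle' := r.T_strictMono.le_iff_le.1 hle
    have h1 := r.ec_count_succ_of_boxIn hn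
    have h2 : j ≤ (r.ecMid n₂).count := by
      rcases hle'.lt_or_eq with hlt | rfl
      · have h3 : (r.ecState (n₁ + 1) (r.who n₁)).count ≤ (r.ecState n₂ (r.who n₁)).count :=
          r.ec_count_mono _ hlt
        rw [← hw] at h1 h3
        rcases r.ecMid_cases n₂ with ⟨-, h4, -⟩ | ⟨-, -, h4, -⟩ <;> omega
      · omega
    -- Nothing is known yet about the responses of the black box, so this one may be stale. If it is
    -- ignored, instance `j` was completed before; otherwise accepting it raises the level to `j`.
    have h3 : ∃ N, j ≤ (r.ecState N (r.who n₁)).level := by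
      rw [← hw]
      cases hpe : (r.ecMid n₂).pending
      · refine ⟨n₂, ?_⟩
        rw [← ecMid_level]
        simpa [ECToETOBState.level, hpe] using h2
      · rcases h2.lt_or_eq with hlt | rfl
        · refine ⟨n₂, ?_⟩
          rw [← ecMid_level]
          simp only [ECToETOBState.level, hpe, if_true]
          omega
        · exact ⟨n₂ + 1,
            (r.ec_level_succ_of_some (r.ecAccepted_eq_some.2 ⟨hn', hpe, rfl⟩)).1.ge⟩
    obtain ⟨N, hN⟩ := h3
    obtain ⟨n, h⟩ := r.exists_lt_count hr hp hN
    obtain ⟨i, -, h1, x, hx⟩ := r.exists_boxIn_of_le_count (Nat.le_add_left 1 j) h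
    exact ⟨r.T i, x, r.timed_eq_some.2 ⟨i, rfl, h1, hx⟩⟩

/-- Some process receives the response `l` to instance `j`. -/
def IsResponse (j : ℕ) (l : List M) : Prop :=
  ∃ n y, r.boxOut n = some (j, y) ∧ decodeList enc y = l

/-- `d` and the level change together, when a response is accepted. Level `0` is excluded because
the initial empty sequence is not a response. -/
theorem isResponse_level {n : ℕ} {p : P} (h : 1 ≤ (r.ecState n p).level) :
    r.IsResponse (r.ecState n p).level (r.ecState n p).d := by
  induction n generalizing p with
  | zero => simp [ecState_zero, ECToETOBState.level] at h
  | succ n ih =>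
    by_cases hp : r.who n = p
    · subst hp
      rcases ha : r.ecAccepted n with _ | ⟨j, y⟩
      · rw [r.ec_level_succ_of_none ha] at h ⊢
        rw [r.ecState_succ_of_none ha, ecMid_d]
        exact ih h
      · rw [(r.ec_level_succ_of_some ha).1, r.ecState_succ_of_some ha]
        exact ⟨n, y, (r.ecAccepted_eq_some.1 ha).1, rfl⟩
    · rw [r.ecState_succ_of_ne hp] at h ⊢
      exact ih h

/-! ### Consequences of the guarantees of EC -/

section Spec

variable {r} (hs : ECSpec r.F (r.timed r.boxIn) (r.timed r.boxOut))

include hs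

/-- A response to `j` follows its invocation, so `j` is at most `count`. If it were not accepted,
`j` would be at most the level, hence answered before, against integrity. -/
theorem ecAccepted_of_boxOut {n : ℕ} {y : ℕ × V} (h : r.boxOut n = some y) :
    r.ecAccepted n = some y := by
  obtain ⟨j, y⟩ := y
  obtain ⟨t, ht, x, hx⟩ := hs.response _ _ _ _ (r.timed_eq_some.2 ⟨n, rfl, rfl, h⟩)
  obtain ⟨i, rfl, hw, hx⟩ := r.timed_eq_some.1 hx
  have hi : i ≤ n := r.T_strictMono.le_iff_le.1 ht
  have h1 := r.ec_count_succ_of_boxIn hx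
  have h2 : j ≤ (r.ecMid n).count := by
    rcases hi.lt_or_eq with hlt | rfl
    · have h3 : (r.ecState (i + 1) (r.who i)).count ≤ (r.ecState n (r.who i)).count :=
        r.ec_count_mono _ hlt
      rw [hw] at h1 h3
      rcases r.ecMid_cases n with ⟨-, h4, -⟩ | ⟨-, -, h4, -⟩ <;> omega
    · omega
  by_contra hna
  have h3 : j ≤ (r.ecMid n).level := by
    unfold ECToETOBState.level
    split_ifs with hpe
    · have : j ≠ (r.ecMid n).count := fun hj => hna (r.ecAccepted_eq_some.2 ⟨h, hpe, hj⟩)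
      omega
    · exact h2
  rw [ecMid_level] at h3
  obtain ⟨-, i₂, -, h4, -, h5, -, z, hz⟩ := r.exists_boxOut_of_le_level (by omega) h3
  have := hs.integrity _ _ _ _ _ _ (r.timed_eq_some.2 ⟨i₂, rfl, h5, hz⟩)
    (r.timed_eq_some.2 ⟨n, rfl, rfl, h⟩)
  exact h4.ne (r.T_strictMono.injective this)

/-- By validity of EC the value returned is the code of a proposal, so decoding never falls back on
the default `[]`. -/
theorem exists_proposal_of_boxOut {n j : ℕ} {y : V} (h : r.boxOut n = some (j, y)) :
    ∃ i ≤ n, (∃ v, r.boxIn i = some (j, v)) ∧ decodeList enc y = r.proposal i := by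
  obtain ⟨q, t, ht, hx⟩ := hs.validity _ _ _ _ (r.timed_eq_some.2 ⟨n, rfl, rfl, h⟩)
  obtain ⟨i, rfl, -, hx⟩ := r.timed_eq_some.1 hx
  obtain ⟨-, -, h1⟩ := r.ec_boxIn_eq_some.1 hx
  rw [Prod.mk.injEq] at h1
  exact ⟨i, r.T_strictMono.le_iff_le.1 ht, ⟨y, hx⟩, by rw [h1.2, decodeList_enc]⟩

/-- A delivered sequence that changes becomes one that was proposed. -/
theorem ec_d_succ (n : ℕ) (p : P) :
    (r.ecState (n + 1) p).d = (r.ecState n p).d ∨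
      ∃ i ≤ n, (r.ecState (n + 1) p).d = r.proposal i := by
  by_cases hp : r.who n = p
  · subst hp
    rcases ha : r.ecAccepted n with _ | ⟨j, y⟩
    · left
      rw [r.ecState_succ_of_none ha, ecMid_d]
    · right
      rw [r.ecState_succ_of_some ha]
      obtain ⟨i, hi, -, h⟩ := exists_proposal_of_boxOut hs (r.ecAccepted_eq_some.1 ha).1
      exact ⟨i, hi, h⟩
  · left
    rw [r.ecState_succ_of_ne hp]

/-- Strong induction, since the sequence adopted may have been proposed by another process at any
earlier step; a batch only adds messages that are new to the proposer. -/
theorem ec_nodup (n : ℕ) (p : P) : (r.ecState n p).d.Nodup := by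
  induction n using Nat.strong_induction_on generalizing p with
  | _ n ih =>
    rcases n with _ | n
    · simp [ecState_zero]
    · rcases ec_d_succ hs n p with h | ⟨i, hi, h⟩ <;> rw [h]
      · exact ih n n.lt_succ_self p
      · exact nodup_append_newBatch (ih i (Nat.lt_succ_of_le hi) _) _

/-- A push is received strictly after it is sent, which gives the gap `i + 1 < n`; this gap becomes
the strict inequality of times in no-creation. -/
theorem ec_no_creation (n : ℕ) (p : P) (m : M)
    (hm : m ∈ (r.ecState n p).d ∨ m ∈ (r.ecState n p).toDeliver) :
    ∃ i, i + 1 < n ∧ r.stim i = .input m := by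
  obtain ⟨src, hsrc, hsrc', -, -⟩ := r.exists_ec_source
  induction n using Nat.strong_induction_on generalizing p with
  | _ n ih =>
    rcases n with _ | n
    · simp [ecState_zero] at hm
    · rcases hm with hm | hm
      · rcases ec_d_succ hs n p with h | ⟨i, hi, h⟩ <;> rw [h] at hm
        · obtain ⟨i, h1, h2⟩ := ih n n.lt_succ_self p (.inl hm)
          exact ⟨i, by omega, h2⟩
        · have : m ∈ (r.ecState i (r.who i)).d ∨ m ∈ (r.ecState i (r.who i)).toDeliver := by
            rcases List.mem_append.1 hm with h | h
            · exact .inl h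
            · exact .inr (mem_newBatch.1 h).1
          obtain ⟨i', h1, h2⟩ := ih i (Nat.lt_succ_of_le hi) _ this
          exact ⟨i', by omega, h2⟩
      · by_cases hp : r.who n = p
        · subst hp
          rw [ecState_succ_toDeliver] at hm
          rcases r.mem_ecMid_toDeliver.1 hm with hm | hm
          · obtain ⟨i, h1, h2⟩ := ih n n.lt_succ_self _ (.inr hm)
            exact ⟨i, by omega, h2⟩
          · obtain ⟨h1, h2⟩ := hsrc' n _ hm
            obtain ⟨h3, h4⟩ := r.receive_origin _ _ h2
            obtain ⟨h5, h6⟩ := hsrc _ _ (r.ec_action_eq_send.1 h4)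
            exact ⟨_, by omega, h6⟩
        · rw [r.ecState_succ_of_ne hp] at hm
          obtain ⟨i, h1, h2⟩ := ih n n.lt_succ_self p (.inr hm)
          exact ⟨i, by omega, h2⟩

theorem eventually_le_level {p : P} (hp : p ∈ r.F.correct) (J : ℕ) :
    ∀ᶠ n in atTop, J ≤ (r.ecState n p).level := by
  obtain ⟨t, v, h⟩ := hs.termination p hp (J + 1) (by omega)
  obtain ⟨n, -, rfl, hn⟩ := r.timed_eq_some.1 h
  have h1 := r.ec_level_succ_of_some (ecAccepted_of_boxOut hs hn)
  filter_upwards [eventually_ge_atTop (n + 1)] with n' hn'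
  have : (r.ecState (n + 1) (r.who n)).level ≤ (r.ecState n' (r.who n)).level :=
    r.ec_level_mono _ hn'
  omega

/-- The level of a correct process tends to infinity and its sequence is a response to the instance
of its level. Validity and agreement both reduce to this criterion. -/
theorem eventually_mem_of_isResponse {m : M} {J : ℕ}
    (hJ : ∀ j, J ≤ j → ∀ l, r.IsResponse j l → m ∈ l) {p : P} (hp : p ∈ r.F.correct) :
    ∀ᶠ n in atTop, m ∈ (r.ecState n p).d := by
  filter_upwards [eventually_le_level hs hp (max J 1)] with n hn
  exact hJ _ ((le_max_left _ _).trans hn) _ (r.isResponse_level ((le_max_right _ _).trans hn))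

theorem exists_isResponse_unique :
    ∃ k, ∀ j, k ≤ j → ∀ l l', r.IsResponse j l → r.IsResponse j l' → l = l' := by
  obtain ⟨k, hk⟩ := hs.agreement
  refine ⟨k, ?_⟩
  rintro j hj _ _ ⟨n, y, h, rfl⟩ ⟨n', y', h', rfl⟩
  rw [hk j hj _ _ _ _ _ _ (r.timed_eq_some.2 ⟨n, rfl, rfl, h⟩)
    (r.timed_eq_some.2 ⟨n', rfl, rfl, h'⟩)]

/-- The proposer of the sequence returned for `j + 1` was then at level `j`: its own `d` was a
response to `j`, and its proposal extends `d`. -/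
theorem exists_isResponse_prefix {j : ℕ} (hj : 1 ≤ j) {l : List M}
    (h : r.IsResponse (j + 1) l) : ∃ l', r.IsResponse j l' ∧ l' <+: l := by
  obtain ⟨n, y, h, rfl⟩ := h
  obtain ⟨i, -, ⟨v, hv⟩, h2⟩ := exists_proposal_of_boxOut hs h
  have h3 := r.ec_count_succ_of_boxIn hv
  obtain ⟨-, h4, -⟩ := r.ec_boxIn_eq_some.1 hv
  have h5 : (r.ecState i (r.who i)).level = j := by
    simp only [ECToETOBState.level, h4]
    simp
    omega
  refine ⟨(r.ecState i (r.who i)).d, ?_, ?_⟩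
  · rw [← h5]
    exact r.isResponse_level (h5.symm ▸ hj)
  · rw [h2]
    exact List.prefix_append _ _

/-- Uniqueness from `k` on joins the links given by `exists_isResponse_prefix` into one chain. -/
theorem isResponse_prefix {k : ℕ} (hk1 : 1 ≤ k)
    (hk : ∀ j, k ≤ j → ∀ l l', r.IsResponse j l → r.IsResponse j l' → l = l') {j j' : ℕ}
    (hj : k ≤ j) (hjj' : j ≤ j') {l l' : List M} (h : r.IsResponse j l)
    (h' : r.IsResponse j' l') : l <+: l' := by
  induction j', hjj' using Nat.le_induction generalizing l' with
  | base => rw [hk j hj l l' h h']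
  | succ j' hj' ih =>
    obtain ⟨l'', h1, h2⟩ := exists_isResponse_prefix hs (by omega) h'
    exact (ih h1).trans h2

theorem ec_validity [Finite P] (hr : r.Admissible) {p : P} (hp : p ∈ r.F.correct) {n₀ : ℕ} {m : M}
    (hw : r.who n₀ = p) (h : r.stim n₀ = .input m) :
    ∀ᶠ n in atTop, m ∈ (r.ecState n p).d := by
  obtain ⟨-, -, -, hin, hrec⟩ := r.exists_ec_source
  obtain ⟨n₁, -, h1⟩ := hin hr p hp n₀ _ hw h
  rw [← ec_action_eq_send] at h1
  have hall : ∀ᶠ n in atTop, ∀ q, q ∈ r.F.correct → m ∈ (r.ecState n q).toDeliver := by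
    rw [eventually_all]
    intro q
    by_cases hq : q ∈ r.F.correct
    · obtain ⟨n₂, h2, h3, -⟩ := hr.messages n₁ _ h1 q hq
      obtain ⟨n₃, rfl, h5⟩ := hrec hr q hq n₂ _ h2 h3
      filter_upwards [eventually_ge_atTop (n₃ + 1)] with n hn _
      refine r.ec_toDeliver_mono _ hn ?_
      simp only [ecState_succ_toDeliver]
      exact r.mem_ecMid_toDeliver.2 (.inr h5)
    · simp [hq]
  -- From `N` on only correct processes move and all of them have `m`. With `J` bounding the
  -- instances invoked before, any proposal to an instance above `J` is made after `N` and contains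
  -- `m`.
  obtain ⟨N, hN⟩ := eventually_atTop.1 (hall.and r.eventually_who_mem_correct)
  obtain ⟨J, hJ⟩ := (Set.finite_range fun q => (r.ecState N q).count).bddAbove
  refine eventually_mem_of_isResponse hs (J := J + 1) ?_ hp
  rintro j hj _ ⟨n, y, hy, rfl⟩
  obtain ⟨i, -, ⟨v, hv⟩, h2⟩ := exists_proposal_of_boxOut hs hy
  have h3 := r.ec_count_succ_of_boxIn hv
  have h4 : (r.ecState N (r.who i)).count ≤ J := hJ (Set.mem_range_self _)
  have h5 : N ≤ i := by
    by_contra! hlt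
    have : (r.ecState (i + 1) (r.who i)).count ≤ (r.ecState N (r.who i)).count :=
      r.ec_count_mono _ hlt
    omega
  rw [h2, proposal, List.mem_append, mem_newBatch]
  have h6 := (hN i h5).1 _ (hN i h5).2
  tauto

theorem ec_agreement {p q : P} (hp : p ∈ r.F.correct) (hq : q ∈ r.F.correct) {m : M}
    (h : ∀ᶠ n in atTop, m ∈ (r.ecState n p).d) : ∀ᶠ n in atTop, m ∈ (r.ecState n q).d := by
  obtain ⟨N, hN⟩ := eventually_atTop.1 h
  obtain ⟨k, hk⟩ := exists_isResponse_unique hs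
  -- Beyond `k` responses are unique. An instance above the level of `p` at `N` is accepted by `p`
  -- only when `m` is already permanent there, so the response contains `m`.
  refine eventually_mem_of_isResponse hs (J := max k ((r.ecState N p).level + 1)) ?_ hq
  intro j hj l hl
  obtain ⟨t, y, hy⟩ := hs.termination p hp j (by omega)
  obtain ⟨n, -, rfl, hn⟩ := r.timed_eq_some.1 hy
  have ha := ecAccepted_of_boxOut hs hn
  have h1 := r.ec_level_succ_of_some ha
  have h2 : N ≤ n + 1 := by
    by_contra! hlt
    have : (r.ecState (n + 1) (r.who n)).level ≤ (r.ecState N (r.who n)).level :=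
      r.ec_level_mono _ hlt.le
    omega
  have h3 := hN _ h2
  rw [r.ecState_succ_of_some ha] at h3
  rwa [hk j (by omega) l _ hl ⟨n, y, hn, rfl⟩]

end Spec

end ECToETOB

end Run

/-- Take the least time from which `m` is always present; by minimality `m` is absent just before.
-/
theorem StablyDelivers.exists_of_eventually {M : Type u} {d : ℕ → List M} {m : M}
    (h : ∀ᶠ t in atTop, m ∈ d t) : ∃ t, StablyDelivers d m t := by
  classical
  have hex : ∃ t, ∀ t', t ≤ t' → m ∈ d t' := eventually_atTop.1 h
  refine ⟨Nat.find hex, fun s hs hm => ?_, Nat.find_spec hex⟩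
  refine Nat.find_min hex (m := s) (by omega) fun t' ht' => ?_
  rcases ht'.lt_or_eq with hlt | rfl
  · exact Nat.find_spec hex t' (by omega)
  · exact hm

theorem AppearsBefore.of_prefix {M : Type u} {l l' : List M} (h : l <+: l') (hl' : l'.Nodup)
    {m₁ m₂ : M} (hm : m₂ ∈ l) (hb : AppearsBefore l' m₁ m₂) : AppearsBefore l m₁ m₂ := by
  obtain ⟨k, rfl⟩ := h
  obtain ⟨a, b, hab, ha, hb⟩ := List.sublist_append_iff.1 hb
  have hdis := (List.nodup_append'.1 hl').2.2
  -- If the part of the pair beyond `l` were nonempty, it would contain `m₂`, which would then occur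
  -- twice in `l'`.
  have hb0 : b = [] := by
    by_contra hne
    have h1 : m₂ ∈ b := by
      have := List.getLast_append_of_ne_nil (l := a) (by simpa using fun _ => hne) hne
      simp only [← hab] at this
      rw [show m₂ = b.getLast hne by simpa using this]
      exact List.getLast_mem hne
    exact hdis hm (hb.subset h1)
  rw [hb0, List.append_nil] at hab
  rw [AppearsBefore, hab]
  exact ha

theorem ecToETOB_isTransformation {P : Type} [Finite P] (E : Environment P) {M V : Type u}
    (enc : List M ↪ V) : IsTransformation E (EC P V) (ETOB P M) (ecToETOB P enc) := by
  intro R D A hA r hr _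
  have hs : ECSpec r.F (r.timed r.boxIn) (r.timed r.boxOut) :=
    r.box_acceptable hr hA (r.ecInputs hr)
  rw [show (fun p => valueAt [] (r.HO p)) = fun p t => (r.ecState (r.stepsUntil t) p).d from
    funext fun p => funext fun t => r.valueAt_ec_HO p t]
  refine ⟨?_, ?_, ?_, ?_, ?_⟩
  · intro p hp m t h
    obtain ⟨n, rfl, hw, h⟩ := r.HI_eq_some.1 h
    obtain ⟨t₀, ht₀⟩ := eventually_atTop.1
      (r.eventually_stepsUntil.2 (Run.ec_validity hs hr hp hw h))
    exact ⟨max t₀ (r.T n + 1), by omega, fun t ht => ht₀ t (by omega)⟩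
  · intro p t m hm
    obtain ⟨i, h1, h2⟩ := Run.ec_no_creation hs _ _ _ (.inl hm)
    refine ⟨r.who i, r.T i, ?_, r.HI_eq_some.2 ⟨i, rfl, rfl, h2⟩⟩
    exact (r.T_strictMono i.lt_succ_self).trans_le (r.lt_stepsUntil_iff.1 h1)
  · exact fun p t => Run.ec_nodup hs _ _
  · intro p hp m t h q hq
    refine StablyDelivers.exists_of_eventually
      ((r.eventually_stepsUntil (q := fun n => m ∈ (r.ecState n q).d)).2
        (Run.ec_agreement hs hp hq ?_))
    exact (r.eventually_stepsUntil (q := fun n => m ∈ (r.ecState n p).d)).1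
      (eventually_atTop.2 ⟨t, h.2⟩)
  · obtain ⟨k, hk⟩ := Run.exists_isResponse_unique hs
    have hk' : ∀ j, max k 1 ≤ j → ∀ l l', r.IsResponse j l → r.IsResponse j l' → l = l' :=
      fun j hj => hk j ((le_max_left _ _).trans hj)
    have hlev : ∀ᶠ n in atTop, ∀ p, p ∈ r.F.correct → max k 1 ≤ (r.ecState n p).level := by
      rw [eventually_all]
      intro p
      by_cases hp : p ∈ r.F.correct
      · filter_upwards [Run.eventually_le_level hs hp (max k 1)] with n hn _ using hn
      · simp [hp]
    obtain ⟨N, hN⟩ := eventually_atTop.1 hlev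
    have hle : ∀ {t}, r.T N ≤ t → ∀ p, p ∈ r.F.correct →
        max k 1 ≤ (r.ecState (r.stepsUntil t) p).level :=
      fun ht => hN _ (r.lt_stepsUntil_iff.2 ht).le
    have hresp : ∀ {t}, r.T N ≤ t → ∀ p, p ∈ r.F.correct →
        r.IsResponse (r.ecState (r.stepsUntil t) p).level (r.ecState (r.stepsUntil t) p).d :=
      fun ht p hp => r.isResponse_level ((le_max_right _ _).trans (hle ht p hp))
    refine ⟨r.T N, fun p hp t₁ t₂ h1 h2 => ?_, fun p hp q hq t ht m₁ m₂ _ h2p _ h2q hb => ?_⟩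
    · exact Run.isResponse_prefix hs (le_max_right _ _) hk' (hle h1 p hp)
        (r.ec_level_mono p (r.stepsUntil_mono h2)) (hresp h1 p hp) (hresp (h1.trans h2) p hp)
    · rcases le_total (r.ecState (r.stepsUntil t) p).level
        (r.ecState (r.stepsUntil t) q).level with h | h
      · exact List.Sublist.trans hb (Run.isResponse_prefix hs (le_max_right _ _) hk'
          (hle ht p hp) h (hresp ht p hp) (hresp ht q hq)).sublist
      · exact AppearsBefore.of_prefix (Run.isResponse_prefix hs (le_max_right _ _) hk'
          (hle ht q hq) h (hresp ht q hq) (hresp ht p hp)) (Run.ec_nodup hs _ _) h2q hb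

/-! ### From ETOB to EC -/

theorem partialInv_eq_some_iff {α β : Type*} (f : α ↪ β) {a : α} {b : β} :
    Function.partialInv f b = some a ↔ f a = b :=
  f.injective.isPartialInv a b

section FirstValue

variable {P : Type} {M V : Type u} {enc : P × ℕ × V ↪ M}

theorem exists_of_firstValue_eq_some {ℓ : ℕ} {d : List M} {v : V}
    (h : firstValue enc ℓ d = some v) :
    ∃ a q b, d = a ++ enc (q, ℓ, v) :: b ∧ ∀ q' v', enc (q', ℓ, v') ∉ a := by
  obtain ⟨a, m, b, rfl, h1, h2⟩ := List.findSome?_eq_some_iff.1 h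
  obtain ⟨⟨q, j, w⟩, h3, h4⟩ := Option.bind_eq_some_iff.1 h1
  rw [partialInv_eq_some_iff] at h3
  simp only [Option.ite_none_right_eq_some, Option.some.injEq] at h4
  obtain ⟨rfl, rfl⟩ := h4
  refine ⟨a, q, b, by rw [h3], fun q' v' hm => ?_⟩
  have := h2 _ hm
  rw [(partialInv_eq_some_iff enc).2 rfl] at this
  simp at this

theorem exists_firstValue_of_mem {ℓ : ℕ} {d : List M} {q : P} {v : V}
    (h : enc (q, ℓ, v) ∈ d) : ∃ w, firstValue enc ℓ d = some w := by
  rw [← Option.isSome_iff_exists, firstValue, List.findSome?_isSome_iff]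
  exact ⟨_, h, by simp [(partialInv_eq_some_iff enc).2 rfl]⟩

/-- The steps of the transformation from ETOB to EC. -/
noncomputable def etobToECStep (enc : P × ℕ × V ↪ M) (p : P) (s : ETOBToECState M) :
    Stimulus PEmpty.{u + 1} (ℕ × V) →
      ETOBToECState M × Command PEmpty.{u + 1} M (ℕ × V)
  | .input x => ({ s with count := x.1, pending := true }, .call (enc (p, x.1, x.2)))
  | .receive m => m.elim
  | .empty =>
      if s.pending then
        match firstValue enc s.count s.d with
        | some v => ({ s with pending := false }, .act (.output (s.count, v)))
        | none => (s, .act .idle)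
      else (s, .act .idle)

theorem etobToEC_step (enc : P × ℕ × V ↪ M) (p : P) (s : ETOBToECState M)
    (e : Stimulus PEmpty.{u + 1} (ℕ × V)) :
    (etobToEC enc).step p s e = etobToECStep enc p s e := by
  cases e <;> rfl

end FirstValue

theorem not_sublist_swap_of_nodup {α : Type u} {l : List α} (hl : l.Nodup) {a b : α}
    (h : List.Sublist [a, b] l) : ¬ List.Sublist [b, a] l := by
  intro h'
  induction l with
  | nil => simp at h
  | cons x l ih =>
    rw [List.nodup_cons] at hl
    rw [List.sublist_cons_iff] at h h'
    have hmem : ∀ {c e : α}, List.Sublist [c, e] l → c ∈ l ∧ e ∈ l := fun h =>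
      ⟨h.subset (by simp), h.subset (by simp)⟩
    rcases h with h | ⟨_, h1, h2⟩ <;> rcases h' with h' | ⟨_, h1', h2'⟩
    · exact ih hl.2 h h'
    · simp only [List.cons.injEq] at h1'
      exact hl.1 (h1'.1 ▸ (hmem h).2)
    · simp only [List.cons.injEq] at h1
      exact hl.1 (h1.1 ▸ (hmem h').2)
    · simp only [List.cons.injEq] at h1 h1'
      rw [← h1.2, List.singleton_sublist] at h2
      exact hl.1 (h1'.1 ▸ h2)

namespace Run

section ETOBToEC

variable {P : Type} {M V R : Type u} {enc : P × ℕ × V ↪ M} {A : Algorithm P R M (List M)}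
  {D : FailureDetector P R} {E : Environment P} (r : Run ((etobToEC enc).apply A) D E)

noncomputable def etobState (n : ℕ) (p : P) : ETOBToECState M := r.user n p

noncomputable def etobMid (n : ℕ) : ETOBToECState M := r.mid n

/-- The stimulus handled by the transformation in the `n`-th step. -/
noncomputable def etobEv (n : ℕ) : Option (Stimulus PEmpty.{u + 1} (ℕ × V)) := r.userEv n

theorem etobMid_eq (n : ℕ) :
    r.etobMid n = (r.etobEv n).elim (r.etobState n (r.who n)) fun e =>
      (etobToECStep enc (r.who n) (r.etobState n (r.who n)) e).1 := by
  simp only [← etobToEC_step]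
  exact r.mid_eq n

theorem etob_boxIn_eq_some {n : ℕ} {m : M} :
    r.boxIn n = some m ↔
      ∃ x, r.etobEv n = some (.input x) ∧ enc (r.who n, x.1, x.2) = m := by
  have h : r.boxIn n = some m ↔ ∃ e, r.etobEv n = some e ∧
      (etobToECStep enc (r.who n) (r.etobState n (r.who n)) e).2 = .call m := by
    simp only [← etobToEC_step]
    exact r.boxIn_eq_some
  rw [h]
  constructor
  · rintro ⟨_ | m | x, he, h⟩
    · simp only [etobToECStep] at h
      split_ifs at h
      · split at h <;> simp at h
    · exact m.elim
    · exact ⟨x, he, by simpa [etobToECStep] using h⟩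
  · rintro ⟨x, he, rfl⟩
    exact ⟨_, he, rfl⟩

/-- In the `n`-th step the application receives the response `v` to instance `j`. -/
def Responds (n j : ℕ) (v : V) : Prop :=
  r.etobEv n = some .empty ∧ (r.etobState n (r.who n)).pending = true ∧
    (r.etobState n (r.who n)).count = j ∧
    firstValue enc j (r.etobState n (r.who n)).d = some v

theorem etob_HO_eq_some {p : P} {t j : ℕ} {v : V} :
    r.HO p t = some (j, v) ↔ ∃ n, r.T n = t ∧ r.who n = p ∧ r.Responds n j v := by
  have h : r.HO p t = some (j, v) ↔ ∃ n, r.T n = t ∧ r.who n = p ∧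
      ((∃ y, r.boxOut n = some y ∧
        (Action.idle : Action PEmpty.{u + 1} (ℕ × V)) = .output (j, v)) ∨
        ∃ e, r.etobEv n = some e ∧
          (etobToECStep enc (r.who n) (r.etobState n (r.who n)) e).2 =
            .act (.output (j, v))) := by
    refine r.HO_eq_some.trans (exists_congr fun n => ?_)
    simp only [← etobToEC_step]
    rfl
  rw [h]
  refine exists_congr fun n => and_congr_right fun _ => and_congr_right fun _ => ?_
  constructor
  · rintro (⟨-, -, h⟩ | ⟨_ | m | x, he, h⟩)
    · cases h
    · simp only [etobToECStep] at h
      split_ifs at h with hp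
      · split at h
        · rename_i w hw
          simp only [Command.act.injEq, Action.output.injEq, Prod.mk.injEq] at h
          obtain ⟨rfl, rfl⟩ := h
          exact ⟨he, hp, rfl, hw⟩
        · simp at h
      · simp at h
    · exact m.elim
    · simp [etobToECStep] at h
  · rintro ⟨h1, h2, rfl, h4⟩
    exact .inr ⟨_, h1, by simp [etobToECStep, h2, h4]⟩

theorem etobState_zero (p : P) : r.etobState 0 p = ⟨[], 0, false⟩ := rfl

theorem etobState_succ_of_ne {n : ℕ} {p : P} (h : r.who n ≠ p) :
    r.etobState (n + 1) p = r.etobState n p := r.user_succ_of_ne h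

theorem etobState_succ (n : ℕ) :
    r.etobState (n + 1) (r.who n) =
      { r.etobMid n with d := (r.boxOut n).getD (r.etobMid n).d } := by
  have h : r.etobState (n + 1) (r.who n) =
      (r.boxOut n).elim (r.etobMid n) fun l => { r.etobMid n with d := l } := r.user_succ n
  rw [h]
  cases r.boxOut n <;> rfl

theorem etobMid_d (n : ℕ) : (r.etobMid n).d = (r.etobState n (r.who n)).d := by
  rw [etobMid_eq]
  rcases r.etobEv n with _ | _ | m | _
  · rfl
  · simp only [etobToECStep, Option.elim]
    split_ifs
    · split <;> rfl
    · rfl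
  · exact m.elim
  · rfl

theorem valueAt_boxOut (p : P) (t : ℕ) :
    valueAt [] (r.timed r.boxOut p) t = (r.etobState (r.stepsUntil t) p).d :=
  r.valueAt_timed (reg := fun n p => (r.etobState n p).d) (fun _ => rfl)
    (fun n p h => by simp only [r.etobState_succ_of_ne h])
    (fun n => by rw [etobState_succ, etobMid_d]) p t

theorem etobState_succ_cases (n : ℕ) :
    (∃ x, r.etobEv n = some (.input x) ∧ (r.etobState (n + 1) (r.who n)).count = x.1 ∧
      (r.etobState (n + 1) (r.who n)).pending = true) ∨
    (∃ v, r.Responds n (r.etobState n (r.who n)).count v ∧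
      (r.etobState (n + 1) (r.who n)).pending = false) ∨
    ((r.etobState (n + 1) (r.who n)).count = (r.etobState n (r.who n)).count ∧
      (r.etobState (n + 1) (r.who n)).pending = (r.etobState n (r.who n)).pending) := by
  rw [etobState_succ]
  simp only [etobMid_eq]
  rcases he : r.etobEv n with _ | _ | m | x
  · simp
  · cases hp : (r.etobState n (r.who n)).pending
    · simp [etobToECStep, hp]
    · rcases hv : firstValue enc (r.etobState n (r.who n)).count (r.etobState n (r.who n)).d
        with _ | v
      · simp [etobToECStep, hp, hv]
      · exact .inr (.inl ⟨v, ⟨he, hp, rfl, hv⟩, by simp [etobToECStep, hp, hv]⟩)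
  · exact m.elim
  · exact .inl ⟨x, rfl, rfl, rfl⟩

theorem Responds.pending_succ {n j : ℕ} {v : V} (h : r.Responds n j v) :
    (r.etobState (n + 1) (r.who n)).pending = false := by
  obtain ⟨h1, h2, rfl, h4⟩ := h
  rw [etobState_succ]
  simp [etobMid_eq, h1, etobToECStep, h2, h4]

/-- An instance becomes pending when its invocation is handled. -/
theorem exists_input_of_pending {n₀ n : ℕ} {p : P} (hn : n₀ ≤ n)
    (h₀ : (r.etobState n₀ p).pending = false) (h : (r.etobState n p).pending = true) :
    ∃ i, n₀ ≤ i ∧ i < n ∧ r.who i = p ∧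
      ∃ v, r.etobEv i = some (.input ((r.etobState n p).count, v)) := by
  induction n, hn using Nat.le_induction with
  | base =>
    rw [h₀] at h
    cases h
  | succ n hn ih =>
    by_cases hp : r.who n = p
    · subst hp
      rcases r.etobState_succ_cases n with ⟨x, h1, h2, -⟩ | ⟨v, -, h2⟩ | ⟨h1, h2⟩
      · exact ⟨n, hn, n.lt_succ_self, rfl, x.2, by rw [h1, h2]⟩
      · rw [h2] at h
        cases h
      · obtain ⟨i, h3, h4, h5⟩ := ih (h2 ▸ h)
        exact ⟨i, h3, by omega, h1 ▸ h5⟩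
    · rw [r.etobState_succ_of_ne hp] at h ⊢
      obtain ⟨i, h3, h4, h5⟩ := ih h
      exact ⟨i, h3, by omega, h5⟩

theorem Responds.exists_input {n j : ℕ} {v : V} (h : r.Responds n j v) :
    ∃ i < n, r.who i = r.who n ∧ ∃ w, r.etobEv i = some (.input (j, w)) := by
  obtain ⟨-, h2, rfl, -⟩ := h
  obtain ⟨i, -, h3, h4⟩ := r.exists_input_of_pending (Nat.zero_le n) rfl h2
  exact ⟨i, h3, h4⟩

/-- Invocations are handled after they are accepted, each at most once, and at a correct process
exactly once. -/
theorem exists_etob_source : ∃ src : ℕ → ℕ,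
    (∀ n x, r.etobEv n = some (.input x) →
      src n ≤ n ∧ r.HI (r.who n) (r.T (src n)) = some x) ∧
    (∀ n n' x x', r.etobEv n = some (.input x) → r.etobEv n' = some (.input x') →
      src n = src n' → n = n') ∧
    (r.Admissible → ∀ p ∈ r.F.correct, ∀ i x, r.HI p (r.T i) = some x →
      ∃ n, i ≤ n ∧ r.who n = p ∧ r.etobEv n = some (.input x)) := by
  obtain ⟨src, h1, h2, h3⟩ := r.exists_user_source
  refine ⟨src, fun n x h => ?_, fun n n' x x' h h' => h2 n n' _ _ h nofun h' nofun,
    fun hr p hp i x h => ?_⟩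
  · obtain ⟨h4, h5, h6⟩ := h1 n _ h nofun
    exact ⟨h4, r.HI_eq_some.2 ⟨_, rfl, h5, r.userArrival_eq_input.1 h6⟩⟩
  · obtain ⟨i', h4, h5, h6⟩ := r.HI_eq_some.1 h
    obtain rfl := r.T_strictMono.injective h4
    obtain ⟨n, h7, h8, h9, -⟩ := h3 hr p hp _ _ h5 (r.userArrival_eq_input.2 h6)
    exact ⟨n, h7, h8, h9⟩

section Inputs

variable {r} (hI : ECInputs r.F r.HI r.HO)

include hI

/-- The application invokes an instance at most once, and an accepted invocation is handled at most
once. -/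
theorem etob_input_unique {n n' j : ℕ} {v v' : V} (hw : r.who n = r.who n')
    (h : r.etobEv n = some (.input (j, v))) (h' : r.etobEv n' = some (.input (j, v'))) :
    n = n' := by
  obtain ⟨src, h1, h2, -⟩ := r.exists_etob_source
  refine h2 _ _ _ _ h h' (r.T_strictMono.injective ?_)
  exact hI.once _ _ _ _ _ _ (h1 n _ h).2 (hw ▸ (h1 n' _ h').2)

/-- No message is broadcast twice. -/
theorem etob_boxIn_unique (p q : P) (t t' : ℕ) (m : M)
    (h : r.timed r.boxIn p t = some m) (h' : r.timed r.boxIn q t' = some m) :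
    p = q ∧ t = t' := by
  obtain ⟨n, rfl, rfl, hn⟩ := r.timed_eq_some.1 h
  obtain ⟨n', rfl, rfl, hn'⟩ := r.timed_eq_some.1 h'
  obtain ⟨x, h1, h2⟩ := r.etob_boxIn_eq_some.1 hn
  obtain ⟨x', h1', h2'⟩ := r.etob_boxIn_eq_some.1 hn'
  -- The coded triple contains the sender and the instance, so equal messages come from the same
  -- invocation.
  have := enc.injective (h2.trans h2'.symm)
  simp only [Prod.mk.injEq] at this
  obtain rfl := etob_input_unique hI (j := x.1) (v := x.2) (v' := x'.2) this.1 h1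
    (by rw [h1', this.2.1])
  exact ⟨rfl, rfl⟩

/-- Instances are invoked after the responses to the preceding ones. -/
theorem ECInputs.exists_response {p : P} {i j t : ℕ} {v : V} (hi : 1 ≤ i) (hij : i < j)
    (h : r.HI p t = some (j, v)) : ∃ t' < t, ∃ w, r.HO p t' = some (i, w) := by
  induction j generalizing t v with
  | zero => omega
  | succ j ih =>
    obtain ⟨t₁, t₂, h1, h2, ⟨x, hx⟩, y, hy⟩ := hI.order _ _ _ _ (by omega) h
    rcases (Nat.le_of_lt_succ hij).lt_or_eq with hlt | rfl
    · obtain ⟨t', h3, h4⟩ := ih hlt hx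
      exact ⟨t', by omega, h4⟩
    · exact ⟨t₂, h2, y, hy⟩

/-- A response clears `pending`; a second one to the same instance would need its invocation to be
handled a second time. -/
theorem etob_integrity {n n' j : ℕ} {v v' : V} (hw : r.who n = r.who n')
    (h : r.Responds n j v) (h' : r.Responds n' j v') : n = n' := by
  have aux : ∀ {n n' : ℕ} {v v' : V}, r.who n = r.who n' → r.Responds n j v →
      r.Responds n' j v' → ¬ n < n' := by
    intro n n' v v' hw h h' hlt
    obtain ⟨i, h1, h2, w, h3⟩ := Responds.exists_input r h
    obtain ⟨-, hp', rfl, -⟩ := h'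
    obtain ⟨i', h4, h5, h6, w', h7⟩ := r.exists_input_of_pending (p := r.who n') hlt
      (hw ▸ Responds.pending_succ r h) hp'
    have := etob_input_unique hI ((h2.trans hw).trans h6.symm) h3 h7
    omega
  rcases lt_trichotomy n n' with h1 | h1 | h1
  · exact absurd h1 (aux hw h h')
  · exact h1
  · exact absurd h1 (aux hw.symm h' h)

theorem exists_responds [Finite P] (hr : r.Admissible)
    (hE : ∀ p ∈ r.F.correct, ∀ n m, r.who n = p → r.boxIn n = some m →
      ∀ᶠ n in atTop, m ∈ (r.etobState n p).d)
    {p : P} (hp : p ∈ r.F.correct) {j t : ℕ} {v : V} (h : r.HI p t = some (j, v)) :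
    ∃ n w, r.who n = p ∧ r.Responds n j w := by
  by_contra! hno
  have hj : 1 ≤ j := hI.pos _ _ _ _ h
  obtain ⟨i₀, rfl, -, -⟩ := r.HI_eq_some.1 h
  obtain ⟨src, hs, -, hs'⟩ := r.exists_etob_source
  obtain ⟨n₀, h1, h2, h3⟩ := hs' hr p hp _ _ h
  -- If no response is ever given, the instance remains current and pending once its invocation has
  -- been handled.
  have hpend : ∀ n, n₀ + 1 ≤ n →
      (r.etobState n p).count = j ∧ (r.etobState n p).pending = true := by
    intro n hn
    induction n, hn using Nat.le_induction with
    | base =>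
      subst h2
      rcases r.etobState_succ_cases n₀ with ⟨x, h4, h5⟩ | ⟨w, h4, -⟩ | h5
      · rw [h3, Option.some.injEq, Stimulus.input.injEq] at h4
        subst h4
        exact h5
      · rw [h4.1] at h3
        simp at h3
      · have := r.etobState_succ n₀
        rw [this]
        simp [etobMid_eq, h3, etobToECStep]
    | succ n hn ih =>
      by_cases hw : r.who n = p
      · subst hw
        rcases r.etobState_succ_cases n with ⟨⟨j', v'⟩, h4, h5⟩ | ⟨w, h4, -⟩ | ⟨h5, h6⟩
        · exfalso
          have hHI := (hs n _ h4).2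
          -- A smaller `j'` was answered before `j` was invoked, hence handled long ago and not now.
          -- A larger one is invoked only after a response to `j`, which was excluded.
          rcases lt_trichotomy j' j with hlt | rfl | hlt
          · obtain ⟨t', h6, w, h7⟩ :=
              ECInputs.exists_response hI (hI.pos _ _ _ _ hHI) hlt h
            obtain ⟨n', rfl, h8, h9⟩ := r.etob_HO_eq_some.1 h7
            obtain ⟨i, h10, h11, w', h12⟩ := Responds.exists_input r h9
            have := etob_input_unique hI (h11.trans h8) h12 h4
            have := r.T_strictMono.lt_iff_lt.1 h6
            omega
          · have := etob_input_unique hI h2 h3 h4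
            omega
          · obtain ⟨t', h6, w, h7⟩ := ECInputs.exists_response hI hj hlt hHI
            obtain ⟨n', -, h8, h9⟩ := r.etob_HO_eq_some.1 h7
            exact hno n' w h8 h9
        · exact absurd (ih.1 ▸ h4) (hno n w rfl)
        · exact ⟨h5.trans ih.1, h6.trans ih.2⟩
      · rw [r.etobState_succ_of_ne hw]
        exact ih
  obtain ⟨N, hN⟩ := eventually_atTop.1
    (hE p hp n₀ _ h2 (r.etob_boxIn_eq_some.2 ⟨_, h3, rfl⟩))
  obtain ⟨n, h4, rfl, h5⟩ := r.exists_timeout hr hp (max N (n₀ + 1))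
  obtain ⟨h6, h7⟩ := hpend n (by omega)
  obtain ⟨w, hw⟩ := exists_firstValue_of_mem (hN n (by omega))
  exact hno n w rfl ⟨h5, h7, h6, hw⟩

end Inputs

end ETOBToEC

end Run

theorem etobToEC_isTransformation {P : Type} [Finite P] (E : Environment P) {M V : Type u}
    (enc : P × ℕ × V ↪ M) : IsTransformation E (ETOB P M) (EC P V) (etobToEC enc) := by
  intro R D A hA r hr hI
  have hE : ETOBSpec r.F (r.timed r.boxIn) fun p => valueAt [] (r.timed r.boxOut p) :=
    r.box_acceptable hr hA (Run.etob_boxIn_unique hI)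
  rw [show (fun p => valueAt [] (r.timed r.boxOut p)) =
    fun p t => (r.etobState (r.stepsUntil t) p).d from
      funext fun p => funext fun t => r.valueAt_boxOut p t] at hE
  have hvalid : ∀ p ∈ r.F.correct, ∀ n m, r.who n = p → r.boxIn n = some m →
      ∀ᶠ n in atTop, m ∈ (r.etobState n p).d := by
    intro p hp n m hw h
    obtain ⟨t', -, h'⟩ := hE.validity p hp m (r.T n) (r.timed_eq_some.2 ⟨n, rfl, hw, h⟩)
    exact r.eventually_stepsUntil.1 (eventually_atTop.2 ⟨t', h'⟩)
  obtain ⟨src, hsrc, -, -⟩ := r.exists_etob_source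
  have hresponse : ∀ p t j v, r.HO p t = some (j, v) →
      ∃ t' ≤ t, ∃ x, r.HI p t' = some (j, x) := by
    intro p t j v h
    obtain ⟨n, rfl, rfl, hn⟩ := r.etob_HO_eq_some.1 h
    obtain ⟨i, h1, h2, w, h3⟩ := Run.Responds.exists_input r hn
    obtain ⟨h4, h5⟩ := hsrc i _ h3
    exact ⟨_, r.T_strictMono.monotone (h4.trans h1.le), w, h2 ▸ h5⟩
  refine ⟨hresponse, ?_, ?_, ?_, ?_⟩
  · intro p hp j hj
    have hresp : ∀ {j t v}, r.HI p t = some (j, v) → ∃ t v, r.HO p t = some (j, v) := by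
      intro j t v h
      obtain ⟨n, w, h1, h2⟩ := Run.exists_responds hI hr hvalid hp h
      exact ⟨r.T n, w, r.etob_HO_eq_some.2 ⟨n, rfl, h1, h2⟩⟩
    induction j, hj using Nat.le_induction with
    | base =>
      obtain ⟨t, v, h⟩ := hI.first p hp
      exact hresp h
    | succ j hj ih =>
      obtain ⟨t, v, h⟩ := ih
      obtain ⟨t', h1, x, h2⟩ := hresponse p t j v h
      obtain ⟨t'', w, h3⟩ := hI.next p hp j t' t x v h1 h2 h
      exact hresp h3
  · intro p j t t' v v' h h'
    obtain ⟨n, rfl, rfl, hn⟩ := r.etob_HO_eq_some.1 h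
    obtain ⟨n', rfl, hw, hn'⟩ := r.etob_HO_eq_some.1 h'
    rw [Run.etob_integrity hI hw.symm hn hn']
  · intro p t j v h
    obtain ⟨n, rfl, rfl, hn⟩ := r.etob_HO_eq_some.1 h
    obtain ⟨a, q, b, h1, -⟩ := exists_of_firstValue_eq_some hn.2.2.2
    -- A response in step `n + 1` reads the sequence as it was at time `T n`, so the triple was
    -- broadcast, and its invocation accepted, before.
    rcases n with _ | n
    · simp [Run.etobState_zero] at h1
    · obtain ⟨q', t', h2, h3⟩ := hE.no_creation (r.who (n + 1)) (r.T n) (enc (q, j, v))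
        (by
          rw [r.stepsUntil_T, h1]
          simp)
      obtain ⟨i, rfl, -, h4⟩ := r.timed_eq_some.1 h3
      obtain ⟨⟨j', v'⟩, h5, h6⟩ := r.etob_boxIn_eq_some.1 h4
      have h7 := enc.injective h6
      simp only [Prod.mk.injEq] at h7
      obtain ⟨-, rfl, rfl⟩ := h7
      obtain ⟨h8, h9⟩ := hsrc i _ h5
      refine ⟨_, _, ?_, h9⟩
      have := r.T_strictMono.lt_iff_lt.1 h2
      exact r.T_strictMono.monotone (by omega)
  · obtain ⟨τ, hstab, horder⟩ := hE.eventually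
    have hN : ∀ᶠ n in atTop, r.who n ∈ r.F.correct ∧ r.stepsUntil τ ≤ n ∧ τ + 1 ≤ n :=
      r.eventually_who_mem_correct.and ((eventually_ge_atTop _).and (eventually_ge_atTop _))
    obtain ⟨N, hN⟩ := eventually_atTop.1 hN
    obtain ⟨k, hk⟩ := ((Set.finite_lt_nat N).image
      fun n => (r.etobState n (r.who n)).count).bddAbove
    -- Before step `N` responses concern only instances up to `k`. Later responders are correct, so
    -- agreement covers the faulty processes as well.
    have hlate : ∀ {n j v}, k + 1 ≤ j → r.Responds n j v → N ≤ n := by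
      intro n j v hj hn
      by_contra! hlt
      have := hk ⟨n, hlt, rfl⟩
      obtain ⟨-, -, h, -⟩ := hn
      simp only at this
      omega
    -- By stability the message answered with remains the first of its instance at the responder,
    -- and by agreement of ETOB it reaches every correct process.
    have hkey : ∀ {n j v}, k + 1 ≤ j → r.Responds n j v →
        ∃ q, ∀ p, p ∈ r.F.correct → ∀ᶠ i in atTop,
          enc (q, j, v) ∈ (r.etobState i p).d ∧
          (∀ q' v', enc (q', j, v') ∈ (r.etobState i (r.who n)).d →
            enc (q', j, v') ≠ enc (q, j, v) →
            AppearsBefore (r.etobState i (r.who n)).d (enc (q, j, v)) (enc (q', j, v'))) := by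
      intro n j v hj hn
      obtain ⟨hcorr, -, hτ⟩ := hN n (hlate hj hn)
      obtain ⟨a, q, b, h1, h2⟩ := exists_of_firstValue_eq_some hn.2.2.2
      obtain ⟨n, rfl⟩ := Nat.exists_eq_add_of_le' (show 1 ≤ n by omega)
      have hlater : ∀ i, n + 1 ≤ i →
          ∃ c, (r.etobState i (r.who (n + 1))).d = a ++ enc (q, j, v) :: (b ++ c) := by
        intro i hi
        obtain ⟨i, rfl⟩ := Nat.exists_eq_add_of_le' (show 1 ≤ i by omega)
        obtain ⟨c, hc⟩ := hstab _ hcorr (r.T n) (r.T i)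
          ((show τ ≤ n by omega).trans (r.T_strictMono.id_le n))
          (r.T_strictMono.monotone (by omega))
        simp only [r.stepsUntil_T] at hc
        exact ⟨c, by rw [← hc, h1]; simp⟩
      have hmem : ∀ᶠ i in atTop, enc (q, j, v) ∈ (r.etobState i (r.who (n + 1))).d := by
        filter_upwards [eventually_ge_atTop (n + 1)] with i hi
        obtain ⟨c, hc⟩ := hlater i hi
        rw [hc]
        simp
      refine ⟨q, fun p hp => ?_⟩
      obtain ⟨t, ht⟩ := StablyDelivers.exists_of_eventually
        ((r.eventually_stepsUntil
          (q := fun i => enc (q, j, v) ∈ (r.etobState i (r.who (n + 1))).d)).2 hmem)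
      obtain ⟨t', -, ht'⟩ := hE.agreement _ hcorr _ _ ht p hp
      filter_upwards [(r.eventually_stepsUntil
          (q := fun i => enc (q, j, v) ∈ (r.etobState i p).d)).1 (eventually_atTop.2 ⟨t', ht'⟩),
        eventually_ge_atTop (n + 1)] with i h3 hi
      refine ⟨h3, fun q' v' h4 hne => ?_⟩
      obtain ⟨c, hc⟩ := hlater i hi
      rw [hc, List.mem_append, List.mem_cons] at h4
      rw [hc]
      have h5 : enc (q', j, v') ∈ b ++ c := by
        have := h2 q' v'
        tauto
      exact ((List.singleton_sublist.2 h5).cons_cons _).trans (List.sublist_append_right _ _)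
    refine ⟨k + 1, fun j hj p p' t t' v v' h h' => ?_⟩
    obtain ⟨n, rfl, rfl, hn⟩ := r.etob_HO_eq_some.1 h
    obtain ⟨n', rfl, rfl, hn'⟩ := r.etob_HO_eq_some.1 h'
    obtain ⟨q, hq⟩ := hkey hj hn
    obtain ⟨q', hq'⟩ := hkey hj hn'
    have hc := (hN n (hlate hj hn)).1
    have hc' := (hN n' (hlate hj hn')).1
    -- At a common late step both responders have both messages, each with its own first, so total
    -- order forces the two messages to coincide.
    obtain ⟨i, ⟨⟨⟨h1, h2⟩, ⟨h3, -⟩⟩, ⟨h4, h5⟩, ⟨h6, -⟩⟩, h7⟩ :=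
      (((hq _ hc).and (hq _ hc')).and ((hq' _ hc').and (hq' _ hc)) |>.and
        (eventually_ge_atTop (τ + 1))).exists
    by_cases heq : enc (q, j, v) = enc (q', j, v')
    · have := enc.injective heq
      simp only [Prod.mk.injEq] at this
      exact this.2.2
    · exfalso
      have hb := h2 q' v' h6 (Ne.symm heq)
      have hb' := h5 q v h3 heq
      obtain ⟨i, rfl⟩ := Nat.exists_eq_add_of_le' (show 1 ≤ i by omega)
      have ho := horder _ hc _ hc' (r.T i)
        ((show τ ≤ i by omega).trans (r.T_strictMono.id_le i)) (enc (q, j, v)) (enc (q', j, v'))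
      have hnd := hE.no_duplication (r.who n') (r.T i)
      simp only [r.stepsUntil_T] at ho hnd
      exact not_sublist_swap_of_nodup hnd (ho h1 h6 h3 h4 hb) hb'

/-! ### Equivalence -/

theorem nonempty_list_embedding (V : Type u) [Infinite V] : Nonempty (List V ↪ V) :=
  (Cardinal.eq.1 (Cardinal.mk_list_eq_mk V)).map Equiv.toEmbedding

/-- A triple becomes a sequence of three elements of `V`, and sequences embed into `V`. -/
theorem nonempty_triple_embedding (P : Type) [Countable P] (V : Type u) [Infinite V] :
    Nonempty (P × ℕ × V ↪ V) := by
  obtain ⟨f, hf⟩ := Countable.exists_injective_nat P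
  obtain ⟨g⟩ := nonempty_list_embedding V
  have i := Infinite.natEmbedding V
  refine ⟨⟨fun x => g [i (f x.1), i x.2.1, x.2.2], ?_⟩⟩
  rintro ⟨p, n, v⟩ ⟨p', n', v'⟩ h
  simpa [hf.eq_iff] using h

end EventualConsistency

theorem theorem1 {P : Type} [Finite P] (E : Environment P) :
    (∀ (M V : Type u) (enc : List M ↪ V),
      IsTransformation E (EC P V) (ETOB P M) (ecToETOB P enc)) ∧
    (∀ (M V : Type u) (enc : P × ℕ × V ↪ M),
      IsTransformation E (ETOB P M) (EC P V) (etobToEC enc)) ∧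
    (∀ M V : Type u, Infinite V → Nonempty (M ≃ V) →
      EquivalentIn E (EC P V) (ETOB P M)) := by
  refine ⟨fun M V enc => ecToETOB_isTransformation E enc,
    fun M V enc => etobToEC_isTransformation E enc, fun M V _ => ?_⟩
  rintro ⟨e⟩
  have : Infinite M := Infinite.of_injective e.symm e.symm.injective
  obtain ⟨f⟩ := nonempty_list_embedding M
  obtain ⟨g⟩ := nonempty_triple_embedding P V
  exact ⟨⟨_, ecToETOB_isTransformation E (f.trans e.toEmbedding)⟩,
    ⟨_, etobToEC_isTransformation E (g.trans e.symm.toEmbedding)⟩⟩
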